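/- Let $R$ be a quasilocal integral domain (a commutative domain with a unique maximal ideal $M$, not necessarily Noetherian) with quotient field $F$, let $\overline{R}$ be the integral closure of $R$ in $F$, and let $n>1$ be an integer. Then the following statements are equivalent. (1) $R$ is a bad Noetherian stable domain of embedding dimension $n$. That is: $R$ is Noetherian of Krull dimension $1$; every nonzero ideal $I$ of $R$ is stable, i.e. projective as a module over its endomorphism ring $\mathrm{End}_R(I)$; $\overline{R}$ is not a finitely generated $R$-module; and the minimal number of generators of $M$ is $n$. (2) $\overline{R}$ is a DVR and the $R$-module $\overline{R}/R$ is a direct sum of $n-1$ nonzero divisible Artinian uniserial $R$-modules. (3) $\overline{R}$ is a DVR and $\overline{R}/R \cong \bigoplus_{i=1}^{n-1} F/\overline{R}$ as $R$-modules. Here a DVR is a discrete valuation ring that is not a field. An $R$-module $L$ is divisible if $cL=L$ for every nonzero $c\in R$, and uniserial if its set of $R$-submodules is linearly ordered by inclusion. -/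

import Mathlib

universe u v w

/-- An ideal `I` is stable if it is projective over its ring of endomorphisms
(acting on `I` by evaluation). -/
def IsStableIdeal {R : Type u} [CommRing R] (I : Ideal R) : Prop :=
  Module.Projective (Module.End R I) I

/-- A domain is stable if every nonzero ideal is stable. -/
def IsStableDomain (R : Type u) [CommRing R] [IsDomain R] : Prop :=
  ∀ I : Ideal R, I ≠ ⊥ → IsStableIdeal I

/-- A bad stable domain: a quasilocal stable domain of Krull dimension `1` whose normalization,
the integral closure of `R` in its quotient field `F`, is not a finite `R`-module. -/
structure IsBadStableDomain (R : Type u) (F : Type v) [CommRing R] [IsDomain R] [Field F]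
    [Algebra R F] [IsFractionRing R F] : Prop where
  isLocalRing : IsLocalRing R
  isStableDomain : IsStableDomain R
  krullDim_eq_one : ringKrullDim R = 1
  not_finite_normalization : ¬ Module.Finite R (integralClosure R F)

/-- The embedding dimension of a quasilocal ring: the least cardinality of a generating set of
its maximal ideal. -/
noncomputable def embeddingDimension (R : Type u) [CommRing R] [IsLocalRing R] : Cardinal.{u} :=
  (IsLocalRing.maximalIdeal R).spanRank

/-- A module is divisible if every nonzerodivisor of the ring maps it onto itself. -/
def IsDivisibleModule (R : Type u) (L : Type w) [CommRing R] [AddCommGroup L] [Module R L] :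
    Prop :=
  ∀ c ∈ nonZeroDivisors R, ∀ l : L, ∃ l' : L, l = c • l'

/-- A module is uniserial if its submodules are linearly ordered by inclusion. -/
def IsUniserialModule (R : Type u) (L : Type w) [CommRing R] [AddCommGroup L] [Module R L] :
    Prop :=
  ∀ A B : Submodule R L, A ≤ B ∨ B ≤ A

/-- The `R`-module `S / R`, for an `R`-algebra `S`. -/
abbrev ExtensionQuotient (R : Type u) (S : Type w) [CommRing R] [CommRing S] [Algebra R S] :
    Type w :=
  S ⧸ LinearMap.range (Algebra.linearMap R S)

/-! Write `V` for the normalization and `M` for the maximal ideal of `R`. The hub of the proof is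
`IsBadNormalization`: `V` is a DVR with `V ≠ R`, `V = R + cV` for every `c ≠ 0` (so `V / R` is
divisible), and `V / R` is naturally a `V`-module.

Stability forces `V` to be quadratic (`isQuadratic_of_isStableDomain`). By Krull-Akizuki there is a
finite subring `S` with `V = S + tV`; as `V` is not finite, some `w ∈ V` has `t ^ i * w ∈ S` but `t
* w ∉ S`. The annihilator of `w` modulo `S` maps onto `S / R` and lies in every maximal ideal of
`V`. Hence `V` is `R` plus its Jacobson radical, so it is local and then a DVR; comparing the
annihilator with `t` by divisibility gives `V = R + tV` (`IsQuadratic.isBadNormalization`).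

Now some `t ∈ R` is a uniformizer of `V`, `M = tV ∩ R` and `M ^ 2 ⊆ tM`. Division by `t` identifies
`M / tR`, a residue space of dimension `n - 1`, with the `t`-torsion of `V / R`. Since `V / R` and
`F / V` are `t`-power torsion and `F / V` is divisible, matching `t`-torsion suffices for `V / R ≅
(F / V) ^ (n - 1)`. Read backwards, this gives (3) → (1), where an element of least value in an
ideal `I` shows that `I` is stable.

For (2) → (3), a divisible uniserial summand is an image of `F`; the multipliers of the kernel form
a valuation ring containing `R`, hence `V`, so the kernel is a power of the uniformizer times `V`
and the summand is `F / V`. -/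

/-- A subalgebra `V` of `F` is quadratic over `R` if every `R`-submodule of `V` containing `R`
is a ring. -/
def IsQuadratic {R : Type u} {F : Type v} [CommRing R] [Field F] [Algebra R F]
    (V : Subalgebra R F) : Prop :=
  ∀ u ∈ V, ∀ w ∈ V, ∃ a b c : R,
    u * w = algebraMap R F a + algebraMap R F b * u + algebraMap R F c * w

/-! ### Endomorphism rings of ideals and dual bases inside `F` -/

section Multipliers

variable {R : Type u} {F : Type v} [CommRing R] [Field F] [Algebra R F]

/-- The subring `I : I` of `F`. -/
def Ideal.multipliers (F : Type v) [Field F] [Algebra R F] (I : Ideal R) : Subalgebra R F where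
  carrier := {q | ∀ y ∈ I, ∃ y' ∈ I, q * algebraMap R F y = algebraMap R F y'}
  mul_mem' := by
    intro a b ha hb y hy
    obtain ⟨y', hy', h⟩ := hb y hy
    obtain ⟨z, hz, h'⟩ := ha y' hy'
    exact ⟨z, hz, by rw [mul_assoc, h, h']⟩
  add_mem' := by
    intro a b ha hb y hy
    obtain ⟨y', hy', h⟩ := hb y hy
    obtain ⟨z, hz, h'⟩ := ha y hy
    exact ⟨z + y', I.add_mem hz hy', by rw [add_mul, h, h', map_add]⟩
  algebraMap_mem' := fun r y hy => ⟨r * y, I.mul_mem_left r hy, by rw [map_mul]⟩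

/-- Endomorphisms of `I` are multiplications by elements of `I : I`. -/
theorem Ideal.mul_end_apply_comm (I : Ideal R) (e : Module.End R I) (x y : I) :
    (x : R) * (e y : R) = y * (e x : R) := by
  have h : (x : R) • y = (y : R) • x := by
    ext; simp [mul_comm]
  have := congrArg (fun z : I => (z : R)) (congrArg e h)
  simpa using this

theorem Ideal.div_end_mem_multipliers [IsFractionRing R F] (I : Ideal R) (e : Module.End R I) (c : I)
    (hc : (c : R) ≠ 0) : algebraMap R F (e c) / algebraMap R F c ∈ I.multipliers F := by
  intro y hy
  refine ⟨e ⟨y, hy⟩, (e ⟨y, hy⟩).2, ?_⟩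
  have hc' : algebraMap R F c ≠ 0 := by simpa using hc
  have := congrArg (algebraMap R F) (I.mul_end_apply_comm e c ⟨y, hy⟩)
  simp only [map_mul] at this
  field_simp
  rw [this]; ring

/-- The dual basis lemma written with fractions. The ideal is rescaled to `I / c`, which contains
`1`, and `ε x` is the fraction by which the `x`-coordinate of `c` acts on `I`. -/
theorem IsStableIdeal.exists_dual_basis [IsFractionRing R F] {I : Ideal R} (hI : IsStableIdeal I) (c : I)
    (hc : (c : R) ≠ 0) : ∃ (σ : Finset I) (ε : I → F),
      (∀ x ∈ σ, ∀ y ∈ I, ε x * (algebraMap R F y / algebraMap R F c) ∈ I.multipliers F) ∧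
      ∑ x ∈ σ, ε x * (algebraMap R F x / algebraMap R F c) = 1 := by
  obtain ⟨s, hs⟩ := hI.out
  have hc' : algebraMap R F c ≠ 0 := by simpa using hc
  refine ⟨(s c).support, fun x => algebraMap R F ((s c x) c) / algebraMap R F c, ?_, ?_⟩
  · intro x _ y hy
    -- The section is only evaluated at `c`; its value at any other `y` is recovered from `y • c = c
    -- • y`.
    have h1 : y • c = (c : R) • (⟨y, hy⟩ : I) := by
      ext; simp [mul_comm]
    have h2 : ∀ (r : R) (z : I), s (r • z) = (algebraMap R (Module.End R I) r) • s z := by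
      intro r z
      rw [← map_smul]; rfl
    have h3 := congrArg s h1
    rw [h2, h2] at h3
    have h4 := congrArg (fun g => ((g x) c : R)) h3
    simp at h4
    have h5 := I.div_end_mem_multipliers (F := F) (s ⟨y, hy⟩ x) c hc
    convert h5 using 1
    have h6 := congrArg (algebraMap R F) h4
    simp only [map_mul] at h6
    field_simp
    linear_combination h6
  · have h1 := hs c
    rw [Finsupp.linearCombination_apply, Finsupp.sum] at h1
    have h2 := congrArg (fun z : I => algebraMap R F (z : R)) h1
    simp only [id, AddSubmonoidClass.coe_finsetSum, map_sum] at h2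
    refine Eq.trans ?_ (div_self hc')
    refine Eq.trans ?_ (congrArg (· / algebraMap R F c) h2)
    simp only [Finset.sum_div]
    refine Finset.sum_congr rfl fun x _ => ?_
    have := congrArg (algebraMap R F) (I.mul_end_apply_comm (s c x) c x)
    simp only [map_mul] at this
    change _ = algebraMap R F ((s c x) x) / _
    field_simp
    linear_combination -this

end Multipliers

/-! ### Stable domains have quadratic normalization -/

section Stable

variable {R : Type u} {F : Type v} [CommRing R] [IsDomain R] [Field F] [Algebra R F]
  [IsFractionRing R F]

/-- Put `J = R + Ru + Rw`, `I = cJ` and `E = I : I`. As `1 ∈ J ⊆ V`, we have `E ⊆ J ⊆ V`.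
Projectivity gives an ideal `q = E : J` of `E` with `qV = V`; since `V` is integral over `E`,
already `q = E`. So `J = E` is a ring, and it contains `u * w`. -/
theorem isQuadratic_of_isStableDomain (hR : IsStableDomain R) :
    IsQuadratic (integralClosure R F) := by
  classical
  intro u hu w hw
  obtain ⟨c, hc⟩ := IsLocalization.exist_integer_multiples_of_finset (nonZeroDivisors R)
    ({u, w} : Finset F)
  obtain ⟨u', hu'⟩ := hc u (by simp)
  obtain ⟨w', hw'⟩ := hc w (by simp)
  have hc0 : (c : R) ≠ 0 := nonZeroDivisors.coe_ne_zero c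
  have hcF : algebraMap R F c ≠ 0 := by simp
  rw [Algebra.smul_def] at hu' hw'
  set I : Ideal R := Ideal.span {(c : R), u', w'} with hIdef
  have hcI : (c : R) ∈ I := Ideal.subset_span (by simp)
  have huI : u' ∈ I := Ideal.subset_span (by simp)
  have hwI : w' ∈ I := Ideal.subset_span (by simp)
  have hmem : ∀ y ∈ I, ∃ a b d : R, algebraMap R F y / algebraMap R F c =
      algebraMap R F a + algebraMap R F b * u + algebraMap R F d * w := by
    intro y hy
    rw [hIdef, Ideal.mem_span_insert] at hy
    obtain ⟨a, z, hz, rfl⟩ := hy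
    rw [Ideal.mem_span_pair] at hz
    obtain ⟨b, d, rfl⟩ := hz
    refine ⟨a, b, d, ?_⟩
    simp only [map_add, map_mul, hu', hw']
    field_simp
    ring
  have hV : ∀ y ∈ I, algebraMap R F y / algebraMap R F c ∈ integralClosure R F := by
    intro y hy
    obtain ⟨a, b, d, h⟩ := hmem y hy
    rw [h]
    exact add_mem (add_mem (algebraMap_mem _ _) (mul_mem (algebraMap_mem _ _) hu))
      (mul_mem (algebraMap_mem _ _) hw)
  have hE : I.multipliers F ≤ integralClosure R F := by
    intro q hq
    obtain ⟨y, hy, h⟩ := hq c hcI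
    rw [← eq_div_iff hcF] at h
    rw [h]
    exact hV y hy
  obtain ⟨σ, ε, h1, h2⟩ := (hR I (fun h => hc0 (by
    rw [h] at hcI; simp at hcI))).exists_dual_basis (F := F) ⟨c, hcI⟩ hc0
  let q : Ideal (I.multipliers F) :=
    { carrier := {x | ∀ y ∈ I, (x : F) * (algebraMap R F y / algebraMap R F c) ∈ I.multipliers F}
      zero_mem' := fun y _ => by simp
      add_mem' := fun {a b} ha hb y hy => by
        simpa [add_mul] using add_mem (ha y hy) (hb y hy)
      smul_mem' := fun a x hx y hy => by
        simpa [mul_assoc] using mul_mem a.2 (hx y hy) }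
  have hint : (Subalgebra.inclusion hE).toRingHom.IsIntegral := by
    intro x
    have hx : IsIntegral R x := by
      rw [← isIntegral_algHom_iff (integralClosure R F).val Subtype.val_injective]
      exact x.2
    obtain ⟨p, hp, hpx⟩ := hx
    refine ⟨p.map (algebraMap R _), hp.map _, ?_⟩
    rw [Polynomial.eval₂_map]
    exact hpx
  have hq : q = ⊤ := by
    rw [← Ideal.map_eq_top_iff (Subalgebra.inclusion hE).toRingHom
      (Subalgebra.inclusion_injective hE) hint, Ideal.eq_top_iff_one]
    have hεE : ∀ x ∈ σ, ε x ∈ I.multipliers F := fun x hx => by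
      simpa [hcF] using h1 x hx c hcI
    have : (1 : integralClosure R F) = ∑ x ∈ σ.attach,
        (⟨algebraMap R F x.1 / algebraMap R F c, hV _ x.1.2⟩ : integralClosure R F) *
        (Subalgebra.inclusion hE ⟨ε x.1, hεE x.1 x.2⟩) := by
      ext
      rw [AddSubmonoidClass.coe_finsetSum]
      simp only [OneMemClass.coe_one, MulMemClass.coe_mul, Subalgebra.coe_inclusion]
      rw [Finset.sum_attach σ (fun x => algebraMap R F x.1 / algebraMap R F c * ε x), ← h2]
      exact Finset.sum_congr rfl fun x _ => mul_comm _ _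
    rw [this]
    exact Ideal.sum_mem _ fun x _ => Ideal.mul_mem_left _ _
      (Ideal.mem_map_of_mem _ (show _ ∈ q from h1 x.1 x.2))
  have h1q : (1 : I.multipliers F) ∈ q := by rw [hq]; trivial
  have huE : u ∈ I.multipliers F := by
    have := h1q u' huI
    rw [hu', mul_div_cancel_left₀ _ hcF] at this
    simpa using this
  obtain ⟨y, hy, h⟩ := huE w' hwI
  obtain ⟨a, b, d, h'⟩ := hmem y hy
  refine ⟨a, b, d, ?_⟩
  rw [← h', ← h, hw']
  field_simp

end Stable

/-! ### Krull-Akizuki through lengths -/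

section Length

variable {R : Type u} [CommRing R] [IsDomain R] [IsNoetherianRing R] [Ring.KrullDimLE 1 R]

open scoped Pointwise in
/-- A quotient of a nonzero ideal which is killed by `t` has length at most that of `R / tR`. -/
theorem Ideal.length_range_le_ord {I : Ideal R} (hI : I ≠ ⊥) {t : R} (ht : t ≠ 0)
    {M : Type w} [AddCommGroup M] [Module R M] (g : I →ₗ[R] M) (hg : ∀ x, t • g x = 0) :
    Module.length R (LinearMap.range g) ≤ Ring.ord R t := by
  have ht' : t ∈ nonZeroDivisors R := mem_nonZeroDivisors_of_ne_zero ht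
  have hle : t • I ≤ I := by
    intro x hx
    obtain ⟨y, hy, rfl⟩ := (Submodule.mem_smul_pointwise_iff_exists _ _ _).1 hx
    exact I.mul_mem_left _ hy
  -- The length of `R / tI` is computed twice, through `R / tR` and through `I / tI`; the remaining
  -- term is the length of `R / I` both times, and it cancels because it is finite.
  have e1 := Module.length_eq_add_of_exact (Ideal.mulQuot t I) (Ideal.quotOfMul t I)
    (Ideal.mulQuot_injective I ht') (Ideal.quotOfMul_surjective I) (Ideal.exact_mulQuot_quotOfMul I)
  have hker : LinearMap.ker ((t • I).mkQ.comp I.subtype) ≤ LinearMap.ker g := by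
    intro x hx
    simp only [LinearMap.mem_ker, LinearMap.comp_apply, Submodule.mkQ_apply,
      Submodule.Quotient.mk_eq_zero] at hx
    obtain ⟨y, hy, hyx⟩ := (Submodule.mem_smul_pointwise_iff_exists _ _ _).1 hx
    have : x = t • (⟨y, hy⟩ : I) := by ext; exact hyx.symm
    rw [LinearMap.mem_ker, this, map_smul, hg]
  have e2 := Module.length_eq_add_of_exact
    (LinearMap.range ((t • I).mkQ.comp I.subtype)).subtype (Submodule.mapQ (t • I) I LinearMap.id hle)
    (Submodule.subtype_injective _)
    (by
      intro x
      obtain ⟨x, rfl⟩ := Submodule.Quotient.mk_surjective _ x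
      exact ⟨Submodule.Quotient.mk x, by simp⟩)
    (by
      intro x
      obtain ⟨x, rfl⟩ := Submodule.Quotient.mk_surjective _ x
      constructor
      · intro h
        simp only [Submodule.mapQ_apply, LinearMap.id_apply, Submodule.Quotient.mk_eq_zero] at h
        exact ⟨⟨_, ⟨⟨x, h⟩, rfl⟩⟩, rfl⟩
      · rintro ⟨⟨_, ⟨y, rfl⟩⟩, h⟩
        rw [← h]
        simp [Ideal.Quotient.eq_zero_iff_mem])
  have hfin : Module.length R (R ⧸ I) ≠ ⊤ := by
    obtain ⟨c, hc, hc0⟩ := Submodule.exists_mem_ne_zero_of_ne_bot hI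
    refine ne_top_of_le_ne_top (Ring.ord_ne_top (mem_nonZeroDivisors_of_ne_zero hc0)) ?_
    refine Module.length_le_of_surjective (Submodule.mapQ (Ideal.span {c}) I LinearMap.id
      ((Ideal.span_singleton_le_iff_mem I).2 hc)) ?_
    intro x
    obtain ⟨x, rfl⟩ := Submodule.Quotient.mk_surjective _ x
    exact ⟨Submodule.Quotient.mk x, by simp⟩
  have e3 : Module.length R (LinearMap.range ((t • I).mkQ.comp I.subtype)) = Ring.ord R t := by
    rw [e1, add_comm] at e2
    exact (ENat.add_left_injective_of_ne_top hfin e2).symm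
  rw [← e3]
  have h4 := Module.length_le_of_surjective
    (Submodule.liftQ (LinearMap.ker ((t • I).mkQ.comp I.subtype)) g.rangeRestrict
      (by simpa using hker)) (by
      rintro ⟨_, ⟨x, rfl⟩⟩
      exact ⟨Submodule.Quotient.mk x, rfl⟩)
  rwa [((t • I).mkQ.comp I.subtype).quotKerEquivRange.length_eq] at h4

/-- A module whose finitely generated submodules have bounded length is finite. -/
theorem Module.finite_of_length_le {R : Type u} [Ring R] {M : Type w} [AddCommGroup M] [Module R M]
    {n : ℕ∞} (hn : n ≠ ⊤) (h : ∀ Q : Submodule R M, Q.FG → Module.length R Q ≤ n) :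
    Module.Finite R M := by
  let s : Set ℕ∞ := {l | ∃ Q : Submodule R M, Q.FG ∧ Module.length R Q = l}
  have hs : s.Nonempty := ⟨_, ⊥, Submodule.fg_bot, rfl⟩
  lift n to ℕ using hn
  have hfin : s.Finite := ((Set.finite_Iic n).image (Nat.cast : ℕ → ℕ∞)).subset (by
    rintro _ ⟨Q, hQ, rfl⟩
    obtain ⟨m, hm⟩ := ENat.ne_top_iff_exists.1 (ne_top_of_le_ne_top (ENat.natCast_ne_top n) (h Q hQ))
    refine ⟨m, ?_, hm⟩
    have := h Q hQ
    rw [← hm] at this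
    exact_mod_cast this)
  -- A finitely generated submodule of greatest length must be everything: adjoining one more
  -- element would strictly increase the length.
  obtain ⟨_, ⟨Q, hQ, rfl⟩, hmax⟩ := hfin.exists_maximal hs
  rw [Module.finite_def]
  convert hQ
  symm
  rw [eq_top_iff]
  intro x _
  by_contra hx
  have hP : (Q ⊔ Submodule.span R {x}).FG := hQ.sup (Submodule.fg_span_singleton x)
  set P := Q ⊔ Submodule.span R {x}
  have hPl : Module.length R P ≠ ⊤ := ne_top_of_le_ne_top (ENat.natCast_ne_top n) (h P hP)
  rw [Module.length_ne_top_iff, isFiniteLength_iff_isNoetherian_isArtinian] at hPl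
  obtain ⟨_, _⟩ := hPl
  have hQP : Q ≤ P := le_sup_left
  have hlt : Q.comap P.subtype ≠ ⊤ := by
    intro h
    have hxP : x ∈ P := Submodule.mem_sup_right (Submodule.mem_span_singleton_self x)
    exact hx (show (⟨x, hxP⟩ : P) ∈ Q.comap P.subtype by rw [h]; trivial)
  have := Submodule.length_lt hlt
  rw [(Submodule.comapSubtypeEquivOfLe hQP).length_eq] at this
  exact absurd (hmax ⟨P, hP, rfl⟩ this.le) (not_le.2 this)

/-- The part of the Krull-Akizuki theorem needed here: a birational extension is finite modulo
nonzero elements of the base. -/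
theorem Subalgebra.exists_fg_add_mul {F : Type v} [Field F] [Algebra R F] [IsFractionRing R F]
    (V : Subalgebra R F) {t : R} (ht : t ≠ 0) :
    ∃ E : Submodule R F, E.FG ∧ E ≤ Subalgebra.toSubmodule V ∧
      ∀ v ∈ V, ∃ e ∈ E, ∃ z ∈ V, v = e + algebraMap R F t * z := by
  classical
  let tV : Submodule R V := LinearMap.range (LinearMap.lsmul R V t)
  have hfin : Module.Finite R (V ⧸ tV) := by
    refine Module.finite_of_length_le (n := Ring.ord R t)
      (Ring.ord_ne_top (mem_nonZeroDivisors_of_ne_zero ht)) ?_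
    rintro Q ⟨s, rfl⟩
    obtain ⟨r, hr⟩ : ∃ r : V ⧸ tV → V, ∀ x, Submodule.Quotient.mk (r x) = x :=
      ⟨_, fun x => (Submodule.Quotient.mk_surjective _ x).choose_spec⟩
    obtain ⟨c, hc⟩ := IsLocalization.exist_integer_multiples_of_finset (nonZeroDivisors R)
      (s.image fun x => (r x : F))
    have hcF : algebraMap R F c ≠ 0 := by simp
    let L : F →ₗ[R] F := LinearMap.lsmul R F c
    -- `I = cV ∩ R`. Division by `c` maps it into `V`, and modulo `tV` its image contains the
    -- generators of `Q`, whose denominators `c` clears.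
    let I : Ideal R := ((Subalgebra.toSubmodule V).map L).comap (Algebra.linearMap R F)
    have hI : ∀ y : I, algebraMap R F y / algebraMap R F c ∈ V := by
      rintro ⟨y, ⟨z, hz, hyz⟩⟩
      have : algebraMap R F c * z = algebraMap R F y := by
        simpa [L, Algebra.smul_def] using hyz
      simp only
      rw [← this, mul_div_cancel_left₀ _ hcF]
      exact hz
    let g0 : I →ₗ[R] V :=
      { toFun := fun y => ⟨algebraMap R F y / algebraMap R F c, hI y⟩
        map_add' := fun x y => by ext; simp [add_div]
        map_smul' := fun a x => by ext; simp [Algebra.smul_def, mul_div_assoc] }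
    have hI0 : I ≠ ⊥ := by
      have : (c : R) ∈ I := ⟨1, one_mem V, by simp [L, Algebra.smul_def]⟩
      intro h
      rw [h] at this
      simp at this
    have key := Ideal.length_range_le_ord hI0 ht (tV.mkQ.comp g0) (by
      intro x
      rw [← map_smul, LinearMap.comp_apply, Submodule.mkQ_apply, Submodule.Quotient.mk_eq_zero,
        map_smul]
      exact ⟨_, rfl⟩)
    refine le_trans ?_ key
    have hle : Submodule.span R (s : Set (V ⧸ tV)) ≤ LinearMap.range (tV.mkQ.comp g0) := by
      rw [Submodule.span_le]
      intro x hx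
      obtain ⟨y, hy⟩ := hc (r x) (Finset.mem_image_of_mem _ hx)
      have hyI : y ∈ I := ⟨r x, (r x).2, hy.symm⟩
      refine ⟨⟨y, hyI⟩, ?_⟩
      rw [LinearMap.comp_apply, Submodule.mkQ_apply]
      convert hr x
      ext
      change algebraMap R F y / algebraMap R F c = _
      rw [hy, Algebra.smul_def, mul_div_cancel_left₀ _ hcF]
    exact Module.length_le_of_injective (Submodule.inclusion hle) (Submodule.inclusion_injective hle)
  obtain ⟨s, hs⟩ := Module.finite_def.1 hfin
  obtain ⟨r, hr⟩ : ∃ r : V ⧸ tV → V, ∀ x, Submodule.Quotient.mk (r x) = x :=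
      ⟨_, fun x => (Submodule.Quotient.mk_surjective _ x).choose_spec⟩
  let E : Submodule R V := Submodule.span R (r '' s)
  refine ⟨E.map V.val.toLinearMap, (Submodule.fg_span (s.finite_toSet.image r)).map _, ?_, ?_⟩
  · rintro _ ⟨x, _, rfl⟩
    exact x.2
  · intro v hv
    have hmap : E.map tV.mkQ = ⊤ := by
      rw [Submodule.map_span, ← Set.image_comp, ← hs]
      congr 1
      convert Set.image_id _ using 2
      ext x
      exact hr x
    have : tV.mkQ ⟨v, hv⟩ ∈ E.map tV.mkQ := by rw [hmap]; trivial
    obtain ⟨e, he, hev⟩ := this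
    rw [eq_comm, Submodule.mkQ_apply, Submodule.mkQ_apply, Submodule.Quotient.eq] at hev
    obtain ⟨z, hz⟩ := hev
    refine ⟨e, ⟨e, he, rfl⟩, z, z.2, ?_⟩
    have := congrArg Subtype.val hz
    simp [Algebra.smul_def] at this
    rw [this]; ring

end Length

/-! ### Annihilators modulo a subring of a quadratic extension -/

section Conductor

variable {R : Type u} {F : Type v} [CommRing R] [Field F] [Algebra R F] {V S : Subalgebra R F}

/-- `z * w` is an `R`-combination of `1`, `z`, `w`, and `s` carries each of these into `S`. For `S =
R` this is the `V`-module structure on `V / R`. -/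
theorem IsQuadratic.conductor_mul_mem (hV : IsQuadratic V) {s z w : F} (hz : z ∈ V) (hw : w ∈ V)
    (hs : s ∈ S) (hsz : s * z ∈ S) (hsw : s * w ∈ S) : s * (z * w) ∈ S := by
  obtain ⟨a, b, c, h⟩ := hV z hz w hw
  have : s * (z * w) = algebraMap R F a * s + algebraMap R F b * (s * z)
      + algebraMap R F c * (s * w) := by rw [h]; ring
  rw [this]
  exact add_mem (add_mem (mul_mem (algebraMap_mem _ _) hs) (mul_mem (algebraMap_mem _ _) hsz))
    (mul_mem (algebraMap_mem _ _) hsw)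

theorem Subalgebra.exists_add_pow_mul {t : R}
    (h : ∀ v ∈ V, ∃ s ∈ S, ∃ z ∈ V, v = s + algebraMap R F t * z) (i : ℕ) :
    ∀ v ∈ V, ∃ s ∈ S, ∃ z ∈ V, v = s + algebraMap R F t ^ i * z := by
  induction i with
  | zero => exact fun v hv => ⟨0, zero_mem _, v, hv, by simp⟩
  | succ i ih =>
    intro v hv
    obtain ⟨s, hs, z, hz, rfl⟩ := ih v hv
    obtain ⟨s', hs', z', hz', rfl⟩ := h z hz
    exact ⟨s + algebraMap R F t ^ i * s', add_mem hs
      (mul_mem (pow_mem (algebraMap_mem _ _) _) hs'), z', hz', by ring⟩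

/-- For a quadratic extension the annihilator of `w` modulo `S` surjects onto `S / R`. -/
theorem IsQuadratic.exists_sub_mul_mem (hV : IsQuadratic V) (hS : S ≤ V) {u w : F} (hu : u ∈ S)
    (hw : w ∈ V) : ∃ c : R, (u - algebraMap R F c) * w ∈ S := by
  obtain ⟨a, b, c, h⟩ := hV u (hS hu) w hw
  refine ⟨c, ?_⟩
  have : (u - algebraMap R F c) * w = algebraMap R F a + algebraMap R F b * u := by
    linear_combination h
  rw [this]
  exact add_mem (algebraMap_mem _ _) (mul_mem (algebraMap_mem _ _) hu)

variable [IsLocalRing R]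

open IsLocalRing in
/-- Elements of the annihilator of `w` modulo `S` are nilpotent modulo the maximal ideal. -/
theorem IsQuadratic.exists_sq_eq (hV : IsQuadratic V) (hS : S ≤ V) {t : R}
    (h : ∀ v ∈ V, ∃ s ∈ S, ∃ z ∈ V, v = s + algebraMap R F t * z) {w : F} (hw : w ∈ V)
    (hwS : w ∉ S) {i : ℕ} (hi : algebraMap R F t ^ i * w ∈ S) {s : F} (hs : s ∈ S)
    (hsw : s * w ∈ S) : ∃ a ∈ maximalIdeal R, ∃ b ∈ maximalIdeal R, ∃ z ∈ V,
      s ^ 2 = algebraMap R F a + algebraMap R F b * s + algebraMap R F t ^ i * z := by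
  have hinv : ∀ b : R, algebraMap R F b * w ∈ S → b ∈ maximalIdeal R := by
    intro b hb
    by_contra hbu
    obtain ⟨c, hc⟩ := (notMem_maximalIdeal.1 hbu).exists_left_inv
    refine hwS ?_
    have : w = algebraMap R F c * (algebraMap R F b * w) := by
      rw [← mul_assoc, ← map_mul, hc, map_one, one_mul]
    rw [this]
    exact mul_mem (algebraMap_mem _ _) hb
  have htS : algebraMap R F t ^ i ∈ S := pow_mem (algebraMap_mem _ _) _
  obtain ⟨s₀, hs₀, z, hz, rfl⟩ := Subalgebra.exists_add_pow_mul h i w hw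
  set τ := algebraMap R F t ^ i with hτ
  have hsz : s * (τ * z) ∈ S := by
    have : s * (τ * z) = s * (s₀ + τ * z) - s * s₀ := by ring
    rw [this]
    exact sub_mem hsw (mul_mem hs hs₀)
  have hττ : τ ^ 2 * z ∈ S := by
    have : τ ^ 2 * z = τ * (s₀ + τ * z) - τ * s₀ := by ring
    rw [this]
    exact sub_mem hi (mul_mem htS hs₀)
  have hzz := hV.conductor_mul_mem hz hz (pow_mem htS 2) hττ hττ
  have hτV : τ ∈ V := hS htS
  have hu : s + τ * z ∈ V := add_mem (hS hs) (mul_mem hτV hz)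
  -- Quadraticity is applied to `s + τ * z` rather than to `s`: the coefficient `b` then multiplies
  -- `τ * z`, which differs from `w` by an element of `S`, so `b` annihilates `w` modulo `S`.
  obtain ⟨a, b', c, habc⟩ := hV _ hu _ hu
  obtain ⟨b, hb⟩ : ∃ b, b = b' + c := ⟨_, rfl⟩
  have hab : (s + τ * z) ^ 2 = algebraMap R F a + algebraMap R F b * (s + τ * z) := by
    rw [hb, map_add]; linear_combination habc
  clear habc hb
  have hbz : algebraMap R F b * (τ * z) ∈ S := by
    have : algebraMap R F b * (τ * z) = s ^ 2 + 2 * (s * (τ * z)) + τ ^ 2 * (z * z)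
        - algebraMap R F a - algebraMap R F b * s := by linear_combination -hab
    rw [this]
    refine sub_mem (sub_mem (add_mem (add_mem (pow_mem hs 2) (mul_mem ?_ hsz)) hzz)
      (algebraMap_mem _ _)) (mul_mem (algebraMap_mem _ _) hs)
    exact ofNat_mem S 2
  have hbm : b ∈ maximalIdeal R := hinv b (by
    rw [mul_add]; exact add_mem (mul_mem (algebraMap_mem _ _) hs₀) hbz)
  set z' := algebraMap R F b * z - 2 * s * z - τ * z * z with hz'
  have hz'V : z' ∈ V := sub_mem (sub_mem (mul_mem (algebraMap_mem _ _) hz)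
    (mul_mem (mul_mem (ofNat_mem V 2) (hS hs)) hz)) (mul_mem (mul_mem hτV hz) hz)
  have hsq : s ^ 2 = algebraMap R F a + algebraMap R F b * s + τ * z' := by
    rw [hz']; linear_combination hab
  refine ⟨a, hinv a ?_, b, hbm, z', hz'V, hsq⟩
  have hτz' : τ * z' ∈ S := by
    have : τ * z' = s ^ 2 - algebraMap R F a - algebraMap R F b * s := by rw [hsq]; ring
    rw [this]
    exact sub_mem (sub_mem (pow_mem hs 2) (algebraMap_mem _ _)) (mul_mem (algebraMap_mem _ _) hs)
  -- Multiplying the equation for `s ^ 2` by `w` shows that `a` annihilates `w` modulo `S` as well,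
  -- once the term `τ * z' * w` is known to lie in `S`.
  have h1 : τ * (z' * (s₀ + τ * z)) ∈ S := hV.conductor_mul_mem hz'V hw htS hτz' hi
  have : algebraMap R F a * (s₀ + τ * z) = s * (s * (s₀ + τ * z))
      - algebraMap R F b * (s * (s₀ + τ * z)) - τ * (z' * (s₀ + τ * z)) := by
    linear_combination -(s₀ + τ * z) * hsq
  rw [this]
  exact sub_mem (sub_mem (mul_mem hs hsw) (mul_mem (algebraMap_mem _ _) hsw)) h1

omit [IsLocalRing R] in
/-- An element of the annihilator of `w` modulo `S` cannot divide a power of `t` outside it. -/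
theorem IsQuadratic.pow_mul_mem (hV : IsQuadratic V) (hS : S ≤ V) {t : R}
    (h : ∀ v ∈ V, ∃ s ∈ S, ∃ z ∈ V, v = s + algebraMap R F t * z) {w : F} (hw : w ∈ V)
    {i j : ℕ} (hi : algebraMap R F t ^ i * w ∈ S) {s y : F} (hs : s ∈ S)
    (hsw : s * w ∈ S) (hy : y ∈ V) (hsy : s * y = algebraMap R F t ^ j) :
    algebraMap R F t ^ j * w ∈ S := by
  have htS : ∀ i, algebraMap R F t ^ i ∈ S := fun i => pow_mem (algebraMap_mem _ _) _
  obtain ⟨s', hs', z, hz, rfl⟩ := Subalgebra.exists_add_pow_mul h i y hy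
  have h1 : algebraMap R F t ^ i * (s * z) ∈ S := by
    have : algebraMap R F t ^ i * (s * z) = algebraMap R F t ^ j - s * s' := by
      rw [← hsy]; ring
    rw [this]
    exact sub_mem (htS j) (mul_mem hs hs')
  have h2 := hV.conductor_mul_mem (mul_mem (hS hs) hz) hw (htS i) h1 hi
  have : algebraMap R F t ^ j * w = s' * (s * w) + algebraMap R F t ^ i * (s * z * w) := by
    rw [← hsy]; ring
  rw [this]
  exact add_mem (mul_mem hs' hsw) h2

end Conductor

/-! ### Denominators in dimension one -/

section Denominators

variable {R : Type u} {F : Type v} [CommRing R] [IsDomain R] [IsLocalRing R] [Field F] [Algebra R F]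
  [IsFractionRing R F]

open IsLocalRing

theorem exists_pow_eq_mul_of_ringKrullDim_eq_one (hR : ringKrullDim R = 1) {t c : R}
    (ht : t ∈ maximalIdeal R) (hc : c ≠ 0) : ∃ (k : ℕ) (d : R), t ^ k = c * d := by
  obtain ⟨k, hk⟩ := (ringKrullDim_eq_one_iff_of_isLocalRing_isDomain.1 hR).2 c hc ht
  exact ⟨k, Ideal.mem_span_singleton.1 hk⟩

theorem exists_pow_mul_eq_algebraMap (hR : ringKrullDim R = 1) {t : R}
    (ht : t ∈ maximalIdeal R) (x : F) :
    ∃ (k : ℕ) (r : R), algebraMap R F t ^ k * x = algebraMap R F r := by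
  obtain ⟨a, b, hb, rfl⟩ := IsFractionRing.div_surjective (A := R) x
  have hb0 : b ≠ 0 := nonZeroDivisors.ne_zero hb
  have hbF : algebraMap R F b ≠ 0 := by simpa using hb0
  obtain ⟨k, d, h⟩ := exists_pow_eq_mul_of_ringKrullDim_eq_one hR ht hb0
  refine ⟨k, d * a, ?_⟩
  rw [← map_pow, h]
  simp only [map_mul]
  field_simp

end Denominators

/-- The ring-theoretic content of being a bad Noetherian stable domain: the normalization `V` is a
discrete valuation ring different from `R`, the quotient `V / R` is divisible, and it is naturally
a `V`-module. -/
structure IsBadNormalization (R : Type u) (F : Type v) [CommRing R] [Field F] [Algebra R F] :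
    Prop where
  isDiscreteValuationRing : IsDiscreteValuationRing (integralClosure R F)
  exists_eq_add : ∀ c : R, c ≠ 0 → ∀ v ∈ integralClosure R F, ∃ r : R, ∃ z ∈ integralClosure R F,
    v = algebraMap R F r + algebraMap R F c * z
  smul_mul_mem : ∀ c : R, ∀ z ∈ integralClosure R F, ∀ y ∈ integralClosure R F,
    algebraMap R F c * z ∈ (⊥ : Subalgebra R F) → algebraMap R F c * y ∈ (⊥ : Subalgebra R F) →
    algebraMap R F c * (z * y) ∈ (⊥ : Subalgebra R F)
  ne_bot : integralClosure R F ≠ ⊥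

/-! ### A non-finite quadratic normalization is a discrete valuation ring -/

section

variable {R : Type u} {F : Type v} [CommRing R] [Field F] [Algebra R F]

/-- A finitely generated submodule of a quadratic extension lies in a finite subring. -/
theorem IsQuadratic.exists_finite_subalgebra {V : Subalgebra R F} (hV : IsQuadratic V)
    {E : Submodule R F} (hE : E.FG) (hEV : E ≤ Subalgebra.toSubmodule V) :
    ∃ S : Subalgebra R F, S ≤ V ∧ E ≤ Subalgebra.toSubmodule S ∧
      (Subalgebra.toSubmodule S).FG := by
  have h1 : (1 : F) ∈ E ⊔ 1 := Submodule.mem_sup_right (Submodule.one_le.1 le_rfl)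
  have hle : E ⊔ 1 ≤ Subalgebra.toSubmodule V :=
    sup_le hEV (Submodule.one_le.2 (one_mem V))
  refine ⟨(E ⊔ 1).toSubalgebra h1 ?_, ?_, ?_, ?_⟩
  · intro x y hx hy
    obtain ⟨a, b, c, h⟩ := hV x (hle hx) y (hle hy)
    rw [h]
    simp only [← Algebra.smul_def]
    refine add_mem (add_mem ?_ (Submodule.smul_mem _ _ hx)) (Submodule.smul_mem _ _ hy)
    rw [Algebra.algebraMap_eq_smul_one]
    exact Submodule.smul_mem _ _ h1
  · exact hle
  · exact le_sup_left
  · exact hE.sup (Submodule.one_eq_span (R := R) (A := F) ▸ Submodule.fg_span_singleton _)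

end

section

variable {R : Type u} {F : Type v} [CommRing R] [IsDomain R] [IsLocalRing R] [Field F] [Algebra R F]
  [IsFractionRing R F]

open IsLocalRing

theorem exists_mem_maximalIdeal_ne_zero (hR : ringKrullDim R = 1) :
    ∃ t ∈ maximalIdeal R, t ≠ 0 := by
  refine Submodule.exists_mem_ne_zero_of_ne_bot fun h => ?_
  exact (ringKrullDim_eq_one_iff_of_isLocalRing_isDomain.1 hR).1 (isField_iff_maximalIdeal_eq.2 h)

omit [IsDomain R] in
theorem exists_ne_zero_mem_comap {V : Subalgebra R F} {I : Ideal V} (hI : I ≠ ⊥) :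
    ∃ a : R, a ≠ 0 ∧ algebraMap R V a ∈ I := by
  obtain ⟨⟨x, hx⟩, hxI, hx0⟩ := Submodule.exists_mem_ne_zero_of_ne_bot hI
  obtain ⟨a, b, hb, rfl⟩ := IsFractionRing.div_surjective (A := R) x
  have hb0 : b ≠ 0 := nonZeroDivisors.ne_zero hb
  have hbF : algebraMap R F b ≠ 0 := by simpa using hb0
  refine ⟨a, ?_, ?_⟩
  · rintro rfl
    exact hx0 (by ext; simp)
  · convert I.mul_mem_left (algebraMap R V b) hxI
    ext
    change algebraMap R F a = algebraMap R F b * (algebraMap R F a / algebraMap R F b)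
    field_simp

/-- An extension that is finite modulo every power of `t` is Noetherian. -/
theorem isNoetherianRing_of_exists_add_pow_mul [IsNoetherianRing R] (hR : ringKrullDim R = 1)
    {V S : Subalgebra R F} (hS : S ≤ V) (hfg : (Subalgebra.toSubmodule S).FG) {t : R}
    (ht : t ∈ maximalIdeal R)
    (h : ∀ v ∈ V, ∃ s ∈ S, ∃ z ∈ V, v = s + algebraMap R F t * z) : IsNoetherianRing V := by
  have hSn : IsNoetherianRing S := by
    have : Module.Finite R S := Module.Finite.iff_fg.2 hfg
    have := isNoetherian_of_isNoetherianRing_of_finite R S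
    exact isNoetherian_of_tower R this
  refine (isNoetherianRing_iff_ideal_fg V).2 fun I => ?_
  by_cases hI : I = ⊥
  · rw [hI]; exact Submodule.fg_bot
  obtain ⟨a, ha, haI⟩ := exists_ne_zero_mem_comap hI
  obtain ⟨k, d, hk⟩ := exists_pow_eq_mul_of_ringKrullDim_eq_one hR ht ha
  have htI : algebraMap R V (t ^ k) ∈ I := by
    rw [hk, map_mul]; exact I.mul_mem_right _ haI
  -- `I` contains `t ^ k`, and modulo `t ^ k` every element of `V` comes from the Noetherian ring
  -- `S`; so `I` is generated by `I ∩ S` and `t ^ k`.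
  have hfgI : ((I.comap (Subalgebra.inclusion hS)).map (Subalgebra.inclusion hS)
      ⊔ Ideal.span {algebraMap R V (t ^ k)}).FG :=
    Submodule.FG.sup (((isNoetherianRing_iff_ideal_fg S).1 hSn _).map
      (Subalgebra.inclusion hS).toRingHom) (Submodule.fg_span_singleton _)
  convert hfgI
  apply le_antisymm
  · intro x hx
    obtain ⟨s, hs, z, hz, hxs⟩ := Subalgebra.exists_add_pow_mul h k x x.2
    have hx' : x = Subalgebra.inclusion hS ⟨s, hs⟩ + ⟨z, hz⟩ * algebraMap R V (t ^ k) := by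
      ext
      change (x : F) = s + z * algebraMap R F (t ^ k)
      rw [hxs, map_pow]; ring
    rw [hx'] at hx ⊢
    refine add_mem (Ideal.mem_sup_left (Ideal.mem_map_of_mem _ ?_)) (Ideal.mem_sup_right
      (Ideal.mul_mem_left _ _ (Ideal.mem_span_singleton_self _)))
    exact (Submodule.add_mem_iff_left I (I.mul_mem_left _ htI)).1 hx
  · refine sup_le Ideal.map_comap_le ((Ideal.span_singleton_le_iff_mem I).2 htI)

omit [IsDomain R] in
theorem algebraMap_mem_of_isMaximal {V : Type*} [CommRing V] [Algebra R V]
    [Algebra.IsIntegral R V] (P : Ideal V) [P.IsMaximal] {a : R} :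
    algebraMap R V a ∈ P ↔ a ∈ maximalIdeal R := by
  have := Ideal.isMaximal_comap_of_isIntegral_of_isMaximal (R := R) P
  rw [← eq_maximalIdeal this]
  rfl

/-- A nonzero prime of `V` contracts to a nonzero prime of `R`, which is `M` by dimension one; by
integrality it is maximal, so it is the unique nonzero prime. -/
theorem isDiscreteValuationRing_integralClosure (hR : ringKrullDim R = 1)
    [IsNoetherianRing (integralClosure R F)] [IsLocalRing (integralClosure R F)] :
    IsDiscreteValuationRing (integralClosure R F) := by
  obtain ⟨t, ht, ht0⟩ := exists_mem_maximalIdeal_ne_zero hR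
  have hnf : ¬ IsField (integralClosure R F) := by
    intro h
    rw [isField_iff_maximalIdeal_eq] at h
    have := (algebraMap_mem_of_isMaximal (maximalIdeal (integralClosure R F))).2 ht
    rw [h, Ideal.mem_bot] at this
    have := congrArg Subtype.val this
    exact ht0 (by simpa using this)
  have hic : IsIntegrallyClosed (integralClosure R F) :=
    (isIntegrallyClosed_iff_isIntegrallyClosedIn F).2 inferInstance
  have htfae : IsDiscreteValuationRing (integralClosure R F) ↔
      IsIntegrallyClosed (integralClosure R F) ∧
        ∃! P : Ideal (integralClosure R F), P ≠ ⊥ ∧ P.IsPrime :=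
    (IsDiscreteValuationRing.TFAE _ hnf).out 0 3
  refine htfae.2 ⟨hic, ExistsUnique.intro (maximalIdeal _)
    ⟨fun h => hnf (isField_iff_maximalIdeal_eq.2 h), inferInstance⟩ ?_⟩
  rintro P ⟨hP, hPp⟩
  refine eq_maximalIdeal (Ideal.isMaximal_of_isIntegral_of_isMaximal_comap (R := R) P ?_)
  obtain ⟨a, ha, haP⟩ := exists_ne_zero_mem_comap hP
  have hle := (ringKrullDim_eq_one_iff_of_isLocalRing_isDomain.1 hR).2 a ha
  have hprime : (P.comap (algebraMap R _)).IsPrime := inferInstance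
  have hle' : maximalIdeal R ≤ P.comap (algebraMap R _) := hle.trans
    (hprime.isRadical.radical_le_iff.2 ((Ideal.span_singleton_le_iff_mem _).2 haP))
  rw [← (maximalIdeal.isMaximal R).eq_of_le hprime.ne_top hle']
  infer_instance

/-- A quadratic normalization which is not finite contains a finite subring `S` and an element `w`
whose annihilator modulo `S` contains a power of `t` but neither `1` nor `t`. -/
theorem IsQuadratic.exists_pow_mul_mem_not_mem [IsNoetherianRing R] (hR : ringKrullDim R = 1)
    {V : Subalgebra R F} (hV : IsQuadratic V) (hfin : ¬ (Subalgebra.toSubmodule V).FG) {t : R}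
    (ht : t ∈ maximalIdeal R) (ht0 : t ≠ 0) :
    ∃ S : Subalgebra R F, S ≤ V ∧ (Subalgebra.toSubmodule S).FG ∧
      (∀ v ∈ V, ∃ s ∈ S, ∃ z ∈ V, v = s + algebraMap R F t * z) ∧
      ∃ w ∈ V, ∃ i : ℕ, algebraMap R F t ^ i * w ∈ S ∧ algebraMap R F t * w ∉ S := by
  have : Ring.KrullDimLE 1 R := Ring.krullDimLE_iff.2 (by simp [hR])
  obtain ⟨E, hE, hEV, hEt⟩ := V.exists_fg_add_mul ht0
  obtain ⟨S, hSV, hES, hS⟩ := hV.exists_finite_subalgebra hE hEV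
  refine ⟨S, hSV, hS, fun v hv => ?_, ?_⟩
  · obtain ⟨e, he, z, hz, h⟩ := hEt v hv
    exact ⟨e, hES he, z, hz, h⟩
  · obtain ⟨w₀, hw₀, hw₀S⟩ : ∃ w ∈ V, w ∉ S := by
      by_contra! h
      have : V = S := le_antisymm h hSV
      rw [this] at hfin
      exact hfin hS
    -- Starting from `w₀ = e + t * w` outside `S`, the quotient `w` satisfies `t * w ∉ S`.
    obtain ⟨e, he, w, hw, rfl⟩ := hEt w₀ hw₀
    obtain ⟨k, r, hk⟩ := exists_pow_mul_eq_algebraMap hR ht w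
    exact ⟨w, hw, k, by rw [hk]; exact algebraMap_mem _ _, fun h => hw₀S (add_mem (hES he) h)⟩

theorem IsQuadratic.isBadNormalization [IsNoetherianRing R] (hR : ringKrullDim R = 1)
    (hV : IsQuadratic (integralClosure R F))
    (hfin : ¬ Module.Finite R (integralClosure R F)) : IsBadNormalization R F := by
  replace hfin : ¬ (Subalgebra.toSubmodule (integralClosure R F)).FG :=
    fun h => hfin (Module.Finite.iff_fg.2 h)
  have hloc : IsNoetherianRing (integralClosure R F) ∧ IsLocalRing (integralClosure R F) := by
    obtain ⟨t, ht, ht0⟩ := exists_mem_maximalIdeal_ne_zero hR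
    obtain ⟨S, hSV, hS, hSt, w, hw, i, hi, hw1⟩ := hV.exists_pow_mul_mem_not_mem hR hfin ht ht0
    refine ⟨isNoetherianRing_of_exists_add_pow_mul hR hSV hS ht hSt, ?_⟩
    have hwS : w ∉ S := fun h => hw1 (mul_mem (algebraMap_mem _ _) h)
    -- Raising the exponent to `i + 1` lets a factor `t` be split off the last term of the equation
    -- for the square, without treating `i = 0` apart.
    have hi' : algebraMap R F t ^ (i + 1) * w ∈ S := by
      rw [pow_succ', mul_assoc]; exact mul_mem (algebraMap_mem _ _) hi
    -- `V` is `R` plus the Jacobson radical: in `v = c + (s - c) + t * z` the square of `s - c` lies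
    -- in every maximal ideal. Locality then passes from `R` to `V`.
    have key : ∀ v : integralClosure R F, ∃ r : R, ∃ x ∈ (⊥ : Ideal (integralClosure R F)).jacobson,
        v = algebraMap R _ r + x := by
      intro v
      obtain ⟨s, hs, z, hz, hv⟩ := hSt v v.2
      obtain ⟨c, hc⟩ := hV.exists_sub_mul_mem hSV hs hw
      have hsc : s - algebraMap R F c ∈ S := sub_mem hs (algebraMap_mem _ _)
      obtain ⟨a, ha, b, hb, y, hy, hsq⟩ := hV.exists_sq_eq hSV hSt hw hwS hi' hsc hc
      refine ⟨c, ⟨s - algebraMap R F c, hSV hsc⟩ + algebraMap R _ t * ⟨z, hz⟩, ?_, ?_⟩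
      · rw [Ideal.jacobson, Ideal.mem_sInf]
        rintro P ⟨-, hP⟩
        have htP := (algebraMap_mem_of_isMaximal P).2 ht
        have haP := (algebraMap_mem_of_isMaximal P).2 ha
        have hbP := (algebraMap_mem_of_isMaximal P).2 hb
        refine P.add_mem (hP.isPrime.mem_of_pow_mem 2 ?_) (P.mul_mem_right _ htP)
        have : (⟨s - algebraMap R F c, hSV hsc⟩ : integralClosure R F) ^ 2 = algebraMap R _ a
            + algebraMap R _ b * ⟨s - algebraMap R F c, hSV hsc⟩
            + algebraMap R _ t * (algebraMap R _ t ^ i * ⟨y, hy⟩) := by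
          ext
          change (s - algebraMap R F c) ^ 2 = algebraMap R F a
            + algebraMap R F b * (s - algebraMap R F c)
            + algebraMap R F t * (algebraMap R F t ^ i * y)
          rw [hsq]; ring
        rw [this]
        exact add_mem (add_mem haP (P.mul_mem_right _ hbP)) (P.mul_mem_right _ htP)
      · ext
        change (v : F) = algebraMap R F c + ((s - algebraMap R F c) + algebraMap R F t * z)
        rw [hv]; ring
    refine IsLocalRing.of_isUnit_or_isUnit_one_sub_self fun v => ?_
    obtain ⟨r, x, hx, rfl⟩ := key v
    rw [Ideal.mem_jacobson_bot] at hx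
    have hunit : ∀ (r : R), IsUnit r → ∀ e : integralClosure R F,
        IsUnit (algebraMap R _ r + x * e) := by
      rintro _ ⟨r, rfl⟩ e
      have := (hx (e * algebraMap R _ (r⁻¹ : Rˣ))).mul (r.isUnit.map (algebraMap R _))
      convert this using 1
      rw [add_mul, mul_assoc, mul_assoc, ← map_mul, Units.inv_mul]
      simp [add_comm]
    rcases isUnit_or_isUnit_one_sub_self r with h | h
    · left
      simpa using hunit r h 1
    · right
      convert hunit _ h (-1) using 1
      simp; ring
  obtain ⟨_, _⟩ := hloc
  have hdvr := isDiscreteValuationRing_integralClosure (F := F) hR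
  have hone : ∀ t ∈ maximalIdeal R, t ≠ 0 → ∀ v ∈ integralClosure R F,
      ∃ s ∈ (⊥ : Subalgebra R F), ∃ z ∈ integralClosure R F, v = s + algebraMap R F t * z := by
    intro t ht ht0 v hv
    obtain ⟨S, hSV, hS, hSt, w, hw, i, hi, hw1⟩ := hV.exists_pow_mul_mem_not_mem hR hfin ht ht0
    obtain ⟨s, hs, z, hz, rfl⟩ := hSt v hv
    obtain ⟨c, hc⟩ := hV.exists_sub_mul_mem hSV hs hw
    have hsc : s - algebraMap R F c ∈ S := sub_mem hs (algebraMap_mem _ _)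
    -- If `s - c` divided `t`, then `t` would annihilate `w` modulo `S`, against the choice of `w`.
    -- So `t` divides `s - c`.
    rcases ValuationRing.dvd_total (⟨s - algebraMap R F c, hSV hsc⟩ : integralClosure R F)
      (algebraMap R _ t) with ⟨y, hy⟩ | ⟨y, hy⟩
    · have := hV.pow_mul_mem hSV hSt hw hi hsc hc (j := 1) y.2
        (by rw [pow_one]; exact (congrArg Subtype.val hy).symm)
      rw [pow_one] at this
      exact absurd this hw1
    · refine ⟨algebraMap R F c, algebraMap_mem _ _, y + z, add_mem y.2 hz, ?_⟩
      have : s - algebraMap R F c = algebraMap R F t * y := congrArg Subtype.val hy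
      linear_combination this
  refine ⟨hdvr, ?_, ?_, ?_⟩
  · intro c hc v hv
    obtain ⟨t, ht, ht0⟩ := exists_mem_maximalIdeal_ne_zero hR
    obtain ⟨k, d, hk⟩ := exists_pow_eq_mul_of_ringKrullDim_eq_one hR ht hc
    obtain ⟨s, hs, z, hz, h⟩ := Subalgebra.exists_add_pow_mul (hone t ht ht0) k v hv
    obtain ⟨r, rfl⟩ := Algebra.mem_bot.1 hs
    exact ⟨r, algebraMap R F d * z, mul_mem (algebraMap_mem _ _) hz, by
      rw [h, ← map_pow, hk, map_mul, mul_assoc]⟩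
  · intro c z hz y hy hcz hcy
    exact hV.conductor_mul_mem hz hy (algebraMap_mem _ _) hcz hcy
  · intro h
    apply hfin
    rw [h, Algebra.toSubmodule_bot]
    exact Submodule.one_eq_span (R := R) (A := F) ▸ Submodule.fg_span_singleton _

end

/-! ### From `IsBadNormalization` back to properties of `R` -/

section StableOfMul

variable {R : Type u} [CommRing R] [IsDomain R]

/-- If `I ^ 2 = x I` for some nonzero `x ∈ I` then `I` is free of rank one over its endomorphism
ring. -/
theorem isStableIdeal_of_exists_mul_eq {I : Ideal R} {x : R} (hx : x ∈ I) (hx0 : x ≠ 0)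
    (h : ∀ y ∈ I, ∀ z ∈ I, ∃ w ∈ I, y * z = x * w) : IsStableIdeal I := by
  let f : Module.End R I →ₗ[Module.End R I] I := LinearMap.toSpanSingleton _ _ ⟨x, hx⟩
  have hf : Function.Bijective f := by
    constructor
    · rw [injective_iff_map_eq_zero]
      intro e he
      have he' : e ⟨x, hx⟩ = 0 := he
      ext y
      have := I.mul_end_apply_comm e ⟨x, hx⟩ y
      rw [he'] at this
      simpa [hx0] using this
    · rintro ⟨y, hy⟩
      choose g hg hg' using fun z : I => h y hy z z.2
      refine ⟨{ toFun := fun z => ⟨g z, hg z⟩, map_add' := ?_, map_smul' := ?_ }, ?_⟩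
      · intro a b
        ext
        refine mul_left_cancel₀ hx0 ?_
        simp only [Submodule.coe_add, mul_add, ← hg']
      · intro r a
        ext
        refine mul_left_cancel₀ hx0 ?_
        simp only [Submodule.coe_smul, smul_eq_mul, RingHom.id_apply, ← hg']
        rw [mul_left_comm, hg', mul_left_comm]
      · ext
        refine mul_left_cancel₀ hx0 ?_
        change x * g ⟨x, hx⟩ = _
        rw [← hg', mul_comm]
  exact Module.Projective.of_equiv (LinearEquiv.ofBijective f hf)

end StableOfMul

section

variable {R : Type u} {F : Type v} [CommRing R] [IsDomain R] [IsLocalRing R] [Field F] [Algebra R F]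
  [IsFractionRing R F]

open IsLocalRing

/-- By lying over, each nonzero prime of `R` is the contraction of a nonzero, hence maximal, prime
of `V`. -/
theorem ringKrullDim_eq_one_of_isDiscreteValuationRing
    [IsDiscreteValuationRing (integralClosure R F)] : ringKrullDim R = 1 := by
  obtain ⟨ϖ, hϖ⟩ := IsDiscreteValuationRing.exists_irreducible (integralClosure R F)
  have hpr : ∀ P : Ideal R, P ≠ ⊥ → P.IsPrime → P = maximalIdeal R := by
    intro P hP hPp
    obtain ⟨Q, -, hQp, hQ⟩ := Ideal.exists_ideal_over_prime_of_isIntegral P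
      (⊥ : Ideal (integralClosure R F)) (by
        rw [← RingHom.ker_eq_comap_bot, (RingHom.injective_iff_ker_eq_bot _).1
          (FaithfulSMul.algebraMap_injective R (integralClosure R F))]
        exact bot_le)
    have hQ0 : Q ≠ ⊥ := by
      rintro rfl
      rw [← RingHom.ker_eq_comap_bot, (RingHom.injective_iff_ker_eq_bot _).1
          (FaithfulSMul.algebraMap_injective R (integralClosure R F))] at hQ
      exact hP hQ.symm
    have : Q.IsMaximal := hQp.isMaximal hQ0
    have h2 := Ideal.isMaximal_comap_of_isIntegral_of_isMaximal (R := R) Q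
    rw [hQ] at h2
    exact eq_maximalIdeal h2
  refine ringKrullDim_eq_one_iff_of_isLocalRing_isDomain.2 ⟨?_, ?_⟩
  · intro h
    obtain ⟨a, ha, haI⟩ := exists_ne_zero_mem_comap (F := F)
      (IsDiscreteValuationRing.not_a_field (integralClosure R F))
    rw [algebraMap_mem_of_isMaximal, isField_iff_maximalIdeal_eq.1 h] at haI
    exact ha haI
  · intro x hx
    rw [Ideal.radical_eq_sInf]
    refine le_sInf fun P ⟨hxP, hP⟩ => ?_
    rw [hpr P ?_ hP]
    rintro rfl
    exact hx ((Ideal.span_singleton_le_iff_mem _).1 hxP)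

omit [IsDomain R] [IsLocalRing R] [IsFractionRing R F] in
theorem integralClosure_ne_top [IsDiscreteValuationRing (integralClosure R F)] :
    integralClosure R F ≠ ⊤ := by
  obtain ⟨ϖ, hϖ⟩ := IsDiscreteValuationRing.exists_irreducible (integralClosure R F)
  intro h
  have h0 : (ϖ : F) ≠ 0 := fun h => hϖ.ne_zero (Subtype.ext h)
  have hm : (ϖ : F)⁻¹ ∈ integralClosure R F := h.ge Algebra.mem_top
  exact hϖ.not_isUnit (IsUnit.of_mul_eq_one ⟨_, hm⟩ (Subtype.ext (mul_inv_cancel₀ h0)))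

end

namespace IsBadNormalization

variable {R : Type u} {F : Type v} [CommRing R] [IsDomain R] [IsLocalRing R] [Field F] [Algebra R F]
  [IsFractionRing R F] (H : IsBadNormalization R F)
include H

open IsLocalRing

/-- Pick a nonzero `a ∈ R` divisible by `ϖ` and write `ϖ = r + a ^ 2 * z`. As `ϖ ^ 2` divides `a ^
2`, `r` is `ϖ` times a unit. -/
theorem exists_irreducible : ∃ t : R, Irreducible (algebraMap R (integralClosure R F) t) := by
  have := H.isDiscreteValuationRing
  obtain ⟨ϖ, hϖ⟩ := IsDiscreteValuationRing.exists_irreducible (integralClosure R F)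
  obtain ⟨a, ha, haI⟩ := exists_ne_zero_mem_comap
    (I := Ideal.span {ϖ}) (by simpa using hϖ.ne_zero)
  rw [Ideal.mem_span_singleton] at haI
  obtain ⟨y, hy⟩ := haI
  obtain ⟨r, z, hz, hrz⟩ := H.exists_eq_add (a ^ 2) (pow_ne_zero 2 ha) ϖ ϖ.2
  refine ⟨r, ?_⟩
  have h1 : algebraMap R (integralClosure R F) r = ϖ * (1 - ϖ * (y ^ 2 * ⟨z, hz⟩)) := by
    have h2 : ϖ = algebraMap R _ r + algebraMap R _ (a ^ 2) * ⟨z, hz⟩ := Subtype.ext hrz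
    rw [map_pow, hy] at h2
    linear_combination -h2
  have h3 : IsUnit (1 - ϖ * (y ^ 2 * ⟨z, hz⟩)) := by
    by_contra h
    have h4 : (1 - ϖ * (y ^ 2 * ⟨z, hz⟩)) ∈ maximalIdeal (integralClosure R F) := h
    have h5 : ϖ ∈ maximalIdeal (integralClosure R F) := hϖ.not_isUnit
    have := add_mem h4 (Ideal.mul_mem_right (y ^ 2 * ⟨z, hz⟩) _ h5)
    rw [sub_add_cancel] at this
    exact (Ideal.ne_top_iff_one _).1 (maximalIdeal.isMaximal _).ne_top this
  rw [h1]
  exact (associated_mul_unit_right _ _ h3).irreducible hϖ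

omit [IsDomain R] in
-- With `u = r + c * z`, `w = s + c * y` and `c` a common denominator, `c ^ 2` carries `z` and `y`
-- into `R`, hence also `z * y`. So `(u - r) * (w - s) ∈ R`.
theorem isQuadratic : IsQuadratic (integralClosure R F) := by
  classical
  intro u hu w hw
  obtain ⟨c, hc⟩ := IsLocalization.exist_integer_multiples_of_finset (nonZeroDivisors R)
    ({u, w} : Finset F)
  obtain ⟨u', hu'⟩ := hc u (by simp)
  obtain ⟨w', hw'⟩ := hc w (by simp)
  rw [Algebra.smul_def] at hu' hw'
  have hc0 : (c : R) ≠ 0 := nonZeroDivisors.coe_ne_zero c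
  obtain ⟨r, z, hz, rfl⟩ := H.exists_eq_add c hc0 u hu
  obtain ⟨s, y, hy, rfl⟩ := H.exists_eq_add c hc0 w hw
  have h := H.smul_mul_mem (c ^ 2 : R) z hz y hy
    (Algebra.mem_bot.2 ⟨u' - c * r, by rw [map_sub, hu', map_pow, map_mul]; ring⟩)
    (Algebra.mem_bot.2 ⟨w' - c * s, by rw [map_sub, hw', map_pow, map_mul]; ring⟩)
  obtain ⟨a, ha⟩ := Algebra.mem_bot.1 h
  refine ⟨a - r * s, s, r, ?_⟩
  rw [map_sub, ha, map_mul, map_pow]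
  ring

/-- If `x ∈ I` has least value, write `y = x * u` and `z = x * w`; expanding `u * w` quadratically
puts `y * z` in `x * I`. -/
theorem isStableDomain : IsStableDomain R := by
  have := H.isDiscreteValuationRing
  intro I hI
  obtain ⟨x, hx, hmin⟩ : ∃ x ∈ I, ∀ y ∈ I,
      algebraMap R (integralClosure R F) x ∣ algebraMap R (integralClosure R F) y := by
    obtain ⟨x, hx, hmin⟩ := exists_minimalFor_of_wellFoundedLT (· ∈ I)
      (fun x => IsDiscreteValuationRing.addVal _ (algebraMap R (integralClosure R F) x))
      ⟨0, I.zero_mem⟩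
    refine ⟨x, hx, fun y hy => ?_⟩
    rw [← IsDiscreteValuationRing.addVal_le_iff_dvd]
    exact (le_total _ _).elim id (fun h => hmin hy h)
  have hx0 : x ≠ 0 := by
    rintro rfl
    refine hI (eq_bot_iff.2 fun y hy => ?_)
    have := hmin y hy
    rw [map_zero, zero_dvd_iff] at this
    simpa using this
  refine isStableIdeal_of_exists_mul_eq hx hx0 fun y hy z hz => ?_
  obtain ⟨u, hu⟩ := hmin y hy
  obtain ⟨w, hw⟩ := hmin z hz
  have hu' : algebraMap R F y = algebraMap R F x * u := congrArg Subtype.val hu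
  have hw' : algebraMap R F z = algebraMap R F x * w := congrArg Subtype.val hw
  obtain ⟨a, b, c, h⟩ := H.isQuadratic u u.2 w w.2
  refine ⟨a * x + b * y + c * z, I.add_mem (I.add_mem (I.mul_mem_left _ hx) (I.mul_mem_left _ hy))
    (I.mul_mem_left _ hz), ?_⟩
  apply IsFractionRing.injective R F
  simp only [map_mul, map_add, hu', hw']
  linear_combination (algebraMap R F x) ^ 2 * h

omit [IsLocalRing R] in
-- A common denominator `c` of finitely many generators would give `cV ⊆ R`, so `V = R + cV = R`.
theorem not_finite : ¬ Module.Finite R (integralClosure R F) := by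
  classical
  intro hfin
  have hfg : (Subalgebra.toSubmodule (integralClosure R F)).FG := Module.Finite.iff_fg.1 hfin
  obtain ⟨s, hs⟩ := hfg
  obtain ⟨c, hc⟩ := IsLocalization.exist_integer_multiples_of_finset (nonZeroDivisors R) s
  have hc0 : (c : R) ≠ 0 := nonZeroDivisors.coe_ne_zero c
  have hle : Subalgebra.toSubmodule (integralClosure R F) ≤
      (Subalgebra.toSubmodule (⊥ : Subalgebra R F)).comap (LinearMap.lsmul R F c) := by
    rw [← hs, Submodule.span_le]
    intro x hx
    exact Algebra.mem_bot.2 (hc x hx)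
  refine H.ne_bot (eq_bot_iff.2 fun v hv => ?_)
  obtain ⟨r, z, hz, rfl⟩ := H.exists_eq_add c hc0 v hv
  refine add_mem (algebraMap_mem _ _) ?_
  have := hle hz
  rw [← Algebra.smul_def]
  exact this

theorem isNoetherianRing (hfg : (maximalIdeal R).FG) : IsNoetherianRing R := by
  have := H.isDiscreteValuationRing
  refine IsNoetherianRing.of_prime fun P hP => ?_
  by_cases h0 : P = ⊥
  · rw [h0]; exact Submodule.fg_bot
  · have : Ring.KrullDimLE 1 R := Ring.krullDimLE_iff.2
      (by simp [ringKrullDim_eq_one_of_isDiscreteValuationRing (R := R) (F := F)])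
    rw [eq_maximalIdeal (hP.isMaximal_of_ne_bot h0)]
    exact hfg

theorem isBadStableDomain : IsBadStableDomain R F := by
  have := H.isDiscreteValuationRing
  exact ⟨inferInstance, H.isStableDomain, ringKrullDim_eq_one_of_isDiscreteValuationRing (F := F),
    H.not_finite⟩

end IsBadNormalization

/-! ### Maps out of `F` built from chains of divisions -/

section Chain

variable {R : Type u} [CommRing R] {M : Type w} [AddCommGroup M] [Module R M]

/-- The chain prescribes the images of the powers `t ^ (-k)`: `x 0 = 0` makes the map from `F` kill
`1`, and `x 1 = b` is the image of `1 / t`. -/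
theorem exists_smul_chain {t : R} (hM : ∀ x : M, ∃ y : M, t • y = x) {b : M} (hb : t • b = 0) :
    ∃ x : ℕ → M, x 0 = 0 ∧ x 1 = b ∧ ∀ k, t • x (k + 1) = x k := by
  choose g hg using hM
  refine ⟨fun k => Nat.rec 0 (fun k _ => Nat.rec b (fun _ z => g z) k) k, rfl, rfl, ?_⟩
  rintro (_ | k)
  · exact hb
  · exact hg _

theorem pow_smul_chain {t : R} {x : ℕ → M} (hx : ∀ k, t • x (k + 1) = x k) (k j : ℕ) :
    t ^ j • x (k + j) = x k := by
  induction j with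
  | zero => simp
  | succ j ih => rw [pow_succ, mul_smul, ← add_assoc, hx, ih]

/-- A sequence of successive divisions by `t` extends to a linear map on `F = R[1/t]`. -/
theorem exists_linearMap_of_smul_chain {F : Type v} [Field F] [Algebra R F]
    [FaithfulSMul R F] {t : R} (ht : ∀ q : F, ∃ (k : ℕ) (r : R),
      algebraMap R F t ^ k * q = algebraMap R F r)
    {x : ℕ → M} (hx : ∀ k, t • x (k + 1) = x k) :
    ∃ f : F →ₗ[R] M, ∀ (q : F) (k : ℕ) (r : R),
      algebraMap R F t ^ k * q = algebraMap R F r → f q = r • x k := by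
  have hwd : ∀ (q : F) (k l : ℕ) (r s : R), algebraMap R F t ^ k * q = algebraMap R F r →
      algebraMap R F t ^ l * q = algebraMap R F s → r • x k = s • x l := by
    intro q k l r s hr hs
    have h : r * t ^ l = s * t ^ k := by
      apply FaithfulSMul.algebraMap_injective R F
      simp only [map_mul, map_pow, ← hr, ← hs]
      ring
    rw [← pow_smul_chain hx k l, ← pow_smul_chain hx l k, ← mul_smul, ← mul_smul, h, add_comm]
  choose K ρ hρ using ht
  have hf : ∀ (q : F) (k : ℕ) (r : R),
      algebraMap R F t ^ k * q = algebraMap R F r → ρ q • x (K q) = r • x k :=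
    fun q k r h => hwd q _ _ _ _ (hρ q) h
  refine ⟨{ toFun := fun q => ρ q • x (K q), map_add' := ?_, map_smul' := ?_ }, hf⟩
  · intro p q
    rw [hf (p + q) (K p + K q) (ρ p * t ^ K q + ρ q * t ^ K p) (by
        simp only [map_add, map_mul, map_pow, ← hρ]; ring), add_smul, mul_smul, mul_smul,
      pow_smul_chain hx, add_comm (K p), pow_smul_chain hx]
  · intro a q
    rw [hf (a • q) (K q) (a * ρ q) (by rw [map_mul, ← hρ, Algebra.smul_def]; ring), mul_smul]
    rfl

/-- Induction on the power of `t` killing an element reduces both claims to the elements killed by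
`t`; divisibility of `N` corrects a preimage of `t • y` to one of `y`. -/
theorem LinearMap.bijective_of_torsion {N : Type*} [AddCommGroup N] [Module R N] {t : R}
    (f : N →ₗ[R] M) (hN : ∀ x : N, ∃ k : ℕ, t ^ k • x = 0) (hM : ∀ x : M, ∃ k : ℕ, t ^ k • x = 0)
    (hdiv : ∀ x : N, ∃ y : N, t • y = x) (hinj : ∀ x, t • x = 0 → f x = 0 → x = 0)
    (hsurj : ∀ y, t • y = 0 → ∃ x, f x = y) : Function.Bijective f := by
  constructor
  · rw [injective_iff_map_eq_zero]
    have : ∀ (k : ℕ) (x : N), t ^ k • x = 0 → f x = 0 → x = 0 := by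
      intro k
      induction k with
      | zero => intro x h _; simpa using h
      | succ k ih =>
        intro x h hx
        refine hinj x (ih _ ?_ ?_) hx
        · rw [← mul_smul, ← pow_succ, h]
        · rw [map_smul, hx, smul_zero]
    intro x hx
    obtain ⟨k, hk⟩ := hN x
    exact this k x hk hx
  · have : ∀ (k : ℕ) (y : M), t ^ k • y = 0 → ∃ x, f x = y := by
      intro k
      induction k with
      | zero => intro y h; exact ⟨0, by rw [map_zero, ← h, pow_zero, one_smul]⟩
      | succ k ih =>
        intro y h
        obtain ⟨x, hx⟩ := ih (t • y) (by rw [← mul_smul, ← pow_succ, h])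
        obtain ⟨z, rfl⟩ := hdiv x
        obtain ⟨x', hx'⟩ := hsurj (y - f z) (by rw [smul_sub, ← hx, map_smul, sub_self])
        exact ⟨x' + z, by rw [map_add, hx', sub_add_cancel]⟩
    intro y
    obtain ⟨k, hk⟩ := hM y
    exact this k y hk

end Chain

/-! ### Comparison of `V / R` with powers of `F / V` -/

section Quotients

variable {R : Type u} {F : Type v} [CommRing R] [Field F] [Algebra R F]

theorem ExtensionQuotient.mk_eq_zero {V : Subalgebra R F} (u : V) :
    (Submodule.Quotient.mk u : ExtensionQuotient R V) = 0 ↔ (u : F) ∈ (⊥ : Subalgebra R F) := by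
  rw [Submodule.Quotient.mk_eq_zero, Algebra.mem_bot]
  constructor
  · rintro ⟨r, rfl⟩
    exact ⟨r, rfl⟩
  · rintro ⟨r, hr⟩
    exact ⟨r, Subtype.ext hr⟩

theorem Subalgebra.quotient_mk_eq_zero {V : Subalgebra R F} (q : F) :
    (Submodule.Quotient.mk q : F ⧸ Subalgebra.toSubmodule V) = 0 ↔ q ∈ V := by
  rw [Submodule.Quotient.mk_eq_zero, Subalgebra.mem_toSubmodule]

theorem Subalgebra.exists_smul_eq_quotient [FaithfulSMul R F] {V : Subalgebra R F} {c : R}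
    (hc : c ≠ 0) (x : F ⧸ Subalgebra.toSubmodule V) : ∃ y, c • y = x := by
  obtain ⟨q, rfl⟩ := Submodule.Quotient.mk_surjective _ x
  have hcF : algebraMap R F c ≠ 0 := by simpa using hc
  refine ⟨Submodule.Quotient.mk (q / algebraMap R F c), ?_⟩
  rw [← Submodule.Quotient.mk_smul, Algebra.smul_def, mul_div_cancel₀ _ hcF]

end Quotients

/-- `y` is a basis of the maximal ideal modulo the element `t`. -/
structure IsBasisModulo {R : Type u} [CommRing R] [IsLocalRing R] (t : R) {d : ℕ}
    (y : Fin d → R) : Prop where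
  mem : ∀ i, y i ∈ IsLocalRing.maximalIdeal R
  exists_eq : ∀ x ∈ IsLocalRing.maximalIdeal R, ∃ (r : Fin d → R) (s : R),
    x = ∑ i, r i * y i + s * t
  mem_of_eq : ∀ (r : Fin d → R) (s : R), ∑ i, r i * y i = s * t →
    ∀ i, r i ∈ IsLocalRing.maximalIdeal R

namespace IsBadNormalization

variable {R : Type u} {F : Type v} [CommRing R] [IsDomain R] [IsLocalRing R] [Field F] [Algebra R F]
  [IsFractionRing R F] (H : IsBadNormalization R F)

open IsLocalRing

omit [IsDomain R] [IsFractionRing R F] in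
theorem mem_maximalIdeal_of_irreducible {t : R}
    (ht : Irreducible (algebraMap R (integralClosure R F) t)) : t ∈ maximalIdeal R :=
  fun h => ht.not_isUnit (h.map _)

omit [IsDomain R] [IsLocalRing R] [IsFractionRing R F] in
theorem ne_zero_of_irreducible {t : R}
    (ht : Irreducible (algebraMap R (integralClosure R F) t)) : t ≠ 0 := by
  rintro rfl
  exact ht.ne_zero (map_zero _)

include H

omit [IsDomain R] in
theorem mem_maximalIdeal_iff {t : R} (ht : Irreducible (algebraMap R (integralClosure R F) t))
    {r : R} : r ∈ maximalIdeal R ↔ algebraMap R F r / algebraMap R F t ∈ integralClosure R F := by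
  have := H.isDiscreteValuationRing
  have htF : algebraMap R F t ≠ 0 := by simpa using ne_zero_of_irreducible ht
  rw [← algebraMap_mem_of_isMaximal (maximalIdeal (integralClosure R F)), ht.maximalIdeal_eq,
    Ideal.mem_span_singleton]
  constructor
  · rintro ⟨z, hz⟩
    have : algebraMap R F r = algebraMap R F t * z := congrArg Subtype.val hz
    rw [this, mul_div_cancel_left₀ _ htF]
    exact z.2
  · intro h
    exact ⟨⟨_, h⟩, Subtype.ext (mul_div_cancel₀ _ htF).symm⟩

theorem exists_pow_mul_eq {t : R} (ht : Irreducible (algebraMap R (integralClosure R F) t))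
    (q : F) : ∃ (k : ℕ) (r : R), algebraMap R F t ^ k * q = algebraMap R F r := by
  have := H.isDiscreteValuationRing
  exact exists_pow_mul_eq_algebraMap (ringKrullDim_eq_one_of_isDiscreteValuationRing (F := F))
    (mem_maximalIdeal_of_irreducible ht) q

omit [IsDomain R] [IsLocalRing R] [IsFractionRing R F] in
theorem exists_smul_eq {c : R} (hc : c ≠ 0) (x : ExtensionQuotient R (integralClosure R F)) :
    ∃ y, c • y = x := by
  obtain ⟨v, rfl⟩ := Submodule.Quotient.mk_surjective _ x
  obtain ⟨r, z, hz, h⟩ := H.exists_eq_add c hc v v.2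
  refine ⟨Submodule.Quotient.mk ⟨z, hz⟩, ?_⟩
  rw [← Submodule.Quotient.mk_smul, eq_comm, ← sub_eq_zero, ← Submodule.Quotient.mk_sub,
    ExtensionQuotient.mk_eq_zero]
  refine Algebra.mem_bot.2 ⟨r, ?_⟩
  change _ = (v : F) - c • z
  rw [h, Algebra.smul_def]; ring

/-- The chain map from `F` kills `V` because `V / R` is a `V`-module: for `q ∈ V` with `t ^ k * q =
r`, `t ^ k` kills `x k`, hence so does `t ^ k * q`. -/
theorem exists_linearMap {t : R} (ht : Irreducible (algebraMap R (integralClosure R F) t))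
    {b : ExtensionQuotient R (integralClosure R F)} (hb : t • b = 0) :
    ∃ g : (F ⧸ Subalgebra.toSubmodule (integralClosure R F)) →ₗ[R]
        ExtensionQuotient R (integralClosure R F),
      ∀ r : R, g (Submodule.Quotient.mk (algebraMap R F r / algebraMap R F t)) = r • b := by
  obtain ⟨x, hx0, hx1, hx⟩ := exists_smul_chain (H.exists_smul_eq (ne_zero_of_irreducible ht)) hb
  obtain ⟨f, hf⟩ := exists_linearMap_of_smul_chain (H.exists_pow_mul_eq ht) hx
  have htF : algebraMap R F t ≠ 0 := by simpa using ne_zero_of_irreducible ht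
  refine ⟨Submodule.liftQ _ f ?_, ?_⟩
  · intro q hq
    obtain ⟨k, r, hr⟩ := H.exists_pow_mul_eq ht q
    rw [LinearMap.mem_ker, hf q k r hr]
    have hk : t ^ k • x k = 0 := by
      have := pow_smul_chain hx 0 k
      rwa [zero_add, hx0] at this
    obtain ⟨w, hw⟩ := Submodule.Quotient.mk_surjective _ (x k)
    rw [← hw, ← Submodule.Quotient.mk_smul, ExtensionQuotient.mk_eq_zero] at hk ⊢
    change (t ^ k) • (w : F) ∈ _ at hk
    change r • (w : F) ∈ _
    rw [Algebra.smul_def] at hk ⊢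
    rw [← hr, mul_assoc, ← map_pow]
    refine H.smul_mul_mem (t ^ k) q hq w w.2 ?_ hk
    rw [map_pow, hr]
    exact algebraMap_mem _ _
  · intro r
    rw [Submodule.liftQ_apply, hf _ 1 r (by rw [pow_one, mul_div_cancel₀ _ htF]), hx1]

omit [IsDomain R] [IsLocalRing R] in
-- The `t`-torsion is `t⁻¹V / V`, and `V = R + tV` allows numerators in `R`.
theorem exists_smul_mk_of_smul_eq_zero {t : R}
    (ht : Irreducible (algebraMap R (integralClosure R F) t))
    {x : F ⧸ Subalgebra.toSubmodule (integralClosure R F)} (hx : t • x = 0) :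
    ∃ r : R, x = Submodule.Quotient.mk (algebraMap R F r / algebraMap R F t) := by
  have htF : algebraMap R F t ≠ 0 := by simpa using ne_zero_of_irreducible ht
  obtain ⟨q, rfl⟩ := Submodule.Quotient.mk_surjective _ x
  rw [← Submodule.Quotient.mk_smul, Subalgebra.quotient_mk_eq_zero, Algebra.smul_def] at hx
  obtain ⟨r, z, hz, h⟩ := H.exists_eq_add t (ne_zero_of_irreducible ht) _ hx
  refine ⟨r, ?_⟩
  rw [← sub_eq_zero, ← Submodule.Quotient.mk_sub, Subalgebra.quotient_mk_eq_zero]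
  convert hz
  field_simp
  linear_combination h

/-- The `i`-th copy of `F / V` is mapped by sending `1 / t` to `y i / t`. The basis property of `y`
modulo `t` is exactly bijectivity on `t`-torsion. -/
theorem nonempty_linearEquiv {t : R} (ht : Irreducible (algebraMap R (integralClosure R F) t))
    {d : ℕ} {y : Fin d → R} (hy : IsBasisModulo t y) :
    Nonempty (ExtensionQuotient R (integralClosure R F) ≃ₗ[R]
      (Fin d → F ⧸ Subalgebra.toSubmodule (integralClosure R F))) := by
  have htF : algebraMap R F t ≠ 0 := by simpa using ne_zero_of_irreducible ht
  have hyV := fun i => (H.mem_maximalIdeal_iff ht).1 (hy.mem i)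
  choose g hg using fun i => H.exists_linearMap ht
    (b := Submodule.Quotient.mk ⟨algebraMap R F (y i) / algebraMap R F t, hyV i⟩) (by
      rw [← Submodule.Quotient.mk_smul, ExtensionQuotient.mk_eq_zero]
      change t • (algebraMap R F (y i) / algebraMap R F t) ∈ _
      rw [Algebra.smul_def, mul_div_cancel₀ _ htF]
      exact algebraMap_mem _ _)
  let f : (Fin d → F ⧸ Subalgebra.toSubmodule (integralClosure R F)) →ₗ[R]
      ExtensionQuotient R (integralClosure R F) := ∑ i, (g i).comp (LinearMap.proj i)
  have hf : ∀ r : Fin d → R,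
      f (fun i => Submodule.Quotient.mk (algebraMap R F (r i) / algebraMap R F t)) =
      Submodule.Quotient.mk (∑ i, r i •
        ⟨algebraMap R F (y i) / algebraMap R F t, hyV i⟩) := by
    intro r
    simp only [f, LinearMap.sum_apply, LinearMap.comp_apply, LinearMap.proj_apply, hg]
    rw [← Submodule.mkQ_apply, map_sum]
    simp only [map_smul, Submodule.mkQ_apply]
  have hcoe : ∀ r : Fin d → R, ((∑ i, r i • ⟨algebraMap R F (y i) / algebraMap R F t, hyV i⟩ :
      integralClosure R F) : F) = algebraMap R F (∑ i, r i * y i) / algebraMap R F t := by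
    intro r
    rw [AddSubmonoidClass.coe_finsetSum, map_sum, Finset.sum_div]
    refine Finset.sum_congr rfl fun i _ => ?_
    change r i • (algebraMap R F (y i) / algebraMap R F t) = _
    rw [Algebra.smul_def, map_mul, mul_div_assoc]
  have hbij : Function.Bijective f := by
    refine f.bijective_of_torsion (t := t) ?_ ?_ ?_ ?_ ?_
    · intro x
      choose q hq using fun i => Submodule.Quotient.mk_surjective _ (x i)
      choose k r hk using fun i => H.exists_pow_mul_eq ht (q i)
      refine ⟨∑ i, k i, ?_⟩
      ext i
      rw [Pi.smul_apply, ← hq i, ← Submodule.Quotient.mk_smul, Pi.zero_apply,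
        Subalgebra.quotient_mk_eq_zero, Algebra.smul_def, map_pow,
        ← Finset.sum_erase_add _ _ (Finset.mem_univ i), pow_add, mul_assoc, hk]
      exact mul_mem (pow_mem (algebraMap_mem _ _) _) (algebraMap_mem _ _)
    · intro x
      obtain ⟨v, rfl⟩ := Submodule.Quotient.mk_surjective _ x
      obtain ⟨k, r, hk⟩ := H.exists_pow_mul_eq ht v
      refine ⟨k, ?_⟩
      rw [← Submodule.Quotient.mk_smul, ExtensionQuotient.mk_eq_zero]
      change (t ^ k) • (v : F) ∈ _
      rw [Algebra.smul_def, map_pow, hk]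
      exact algebraMap_mem _ _
    · intro x
      choose z hz using fun i =>
        Subalgebra.exists_smul_eq_quotient (ne_zero_of_irreducible ht) (x i)
      exact ⟨z, funext hz⟩
    · intro x htx hfx
      choose r hr using fun i => H.exists_smul_mk_of_smul_eq_zero ht (congrFun htx i)
      obtain rfl : x = _ := funext hr
      rw [hf, ExtensionQuotient.mk_eq_zero, hcoe] at hfx
      obtain ⟨s, hs⟩ := Algebra.mem_bot.1 hfx
      rw [eq_div_iff htF, ← map_mul] at hs
      have := hy.mem_of_eq r s (IsFractionRing.injective R F hs).symm
      ext i
      exact (Subalgebra.quotient_mk_eq_zero _).2 ((H.mem_maximalIdeal_iff ht).1 (this i))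
    · intro x htx
      obtain ⟨v, rfl⟩ := Submodule.Quotient.mk_surjective _ x
      rw [← Submodule.Quotient.mk_smul, ExtensionQuotient.mk_eq_zero] at htx
      obtain ⟨a, ha⟩ := Algebra.mem_bot.1 htx
      change _ = t • (v : F) at ha
      rw [Algebra.smul_def] at ha
      have hv : (v : F) = algebraMap R F a / algebraMap R F t := by
        rw [ha, mul_div_cancel_left₀ _ htF]
      obtain ⟨r, s, hrs⟩ := hy.exists_eq a ((H.mem_maximalIdeal_iff ht).2 (hv ▸ v.2))
      refine ⟨fun i => Submodule.Quotient.mk (algebraMap R F (r i) / algebraMap R F t), ?_⟩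
      rw [hf, ← sub_eq_zero, ← Submodule.Quotient.mk_sub, ExtensionQuotient.mk_eq_zero]
      refine Algebra.mem_bot.2 ⟨-s, ?_⟩
      rw [AddSubgroupClass.coe_sub, hcoe, hv, hrs]
      simp only [map_add, map_mul, map_neg]
      field_simp
      ring
  exact ⟨(LinearEquiv.ofBijective f hbij).symm⟩

end IsBadNormalization

section

variable {R : Type u} {F : Type v} [CommRing R] [IsDomain R] [IsLocalRing R] [Field F] [Algebra R F]
  [IsFractionRing R F]

open IsLocalRing

omit [IsDomain R] [IsLocalRing R] in
-- An `R`-isomorphism suffices to transport the `V`-structure: if `a = c * z` is in `R` and `c`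
-- kills the class of `y`, then `a` kills its image, `F / V` being a `V`-module, hence kills the
-- class itself. Here `d ≠ 0` gives `V ≠ R`.
theorem isBadNormalization_of_linearEquiv [IsDiscreteValuationRing (integralClosure R F)] {d : ℕ}
    (hd : d ≠ 0) (φ : ExtensionQuotient R (integralClosure R F) ≃ₗ[R]
      (Fin d → F ⧸ Subalgebra.toSubmodule (integralClosure R F))) : IsBadNormalization R F := by
  refine ⟨inferInstance, ?_, ?_, ?_⟩
  · intro c hc v hv
    choose η hη using fun i =>
      Subalgebra.exists_smul_eq_quotient hc (φ (Submodule.Quotient.mk ⟨v, hv⟩) i)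
    obtain ⟨z, hz⟩ := Submodule.Quotient.mk_surjective _ (φ.symm η)
    have h : c • (Submodule.Quotient.mk z : ExtensionQuotient R (integralClosure R F)) =
        Submodule.Quotient.mk ⟨v, hv⟩ := by
      rw [hz, ← map_smul, LinearEquiv.symm_apply_eq]
      exact funext hη
    rw [← Submodule.Quotient.mk_smul, eq_comm, ← sub_eq_zero, ← Submodule.Quotient.mk_sub,
      ExtensionQuotient.mk_eq_zero] at h
    obtain ⟨r, hr⟩ := Algebra.mem_bot.1 h
    refine ⟨r, z, z.2, ?_⟩
    have hr' : algebraMap R F r = v - c • (z : F) := hr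
    rw [hr', Algebra.smul_def]; ring
  · intro c z hz y hy hcz hcy
    obtain ⟨a, ha⟩ := Algebra.mem_bot.1 hcz
    have h0 : c • φ (Submodule.Quotient.mk ⟨y, hy⟩) = 0 := by
      rw [← map_smul, ← Submodule.Quotient.mk_smul, LinearEquiv.map_eq_zero_iff,
        ExtensionQuotient.mk_eq_zero]
      change c • y ∈ _
      rwa [Algebra.smul_def]
    have h1 : a • φ (Submodule.Quotient.mk ⟨y, hy⟩) = 0 := by
      ext i
      obtain ⟨q, hq⟩ := Submodule.Quotient.mk_surjective _ (φ (Submodule.Quotient.mk ⟨y, hy⟩) i)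
      have h2 := congrFun h0 i
      rw [Pi.smul_apply, Pi.zero_apply, ← hq, ← Submodule.Quotient.mk_smul,
        Subalgebra.quotient_mk_eq_zero, Algebra.smul_def] at h2 ⊢
      rw [ha, mul_right_comm]
      exact mul_mem h2 hz
    rw [← map_smul, ← Submodule.Quotient.mk_smul, LinearEquiv.map_eq_zero_iff,
      ExtensionQuotient.mk_eq_zero] at h1
    change a • y ∈ _ at h1
    rwa [Algebra.smul_def, ha, mul_assoc] at h1
  · intro h
    refine integralClosure_ne_top (R := R) (F := F) (eq_top_iff.2 fun q _ => ?_)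
    obtain ⟨v, hv⟩ := Submodule.Quotient.mk_surjective _ (φ.symm fun _ => Submodule.Quotient.mk q)
    have hv0 : (Submodule.Quotient.mk v : ExtensionQuotient R (integralClosure R F)) = 0 := by
      rw [ExtensionQuotient.mk_eq_zero, ← h]
      exact v.2
    rw [hv0, eq_comm, LinearEquiv.map_eq_zero_iff] at hv
    exact (Subalgebra.quotient_mk_eq_zero q).1 (congrFun hv ⟨0, Nat.pos_of_ne_zero hd⟩)

omit [IsDomain R] in
-- The class of `1 / t` in the `i`-th coordinate pulls back to the class of some `u i ∈ V`; then `y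
-- i = t * u i` lies in `R`.
theorem IsBadNormalization.exists_isBasisModulo (H : IsBadNormalization R F) {t : R}
    (ht : Irreducible (algebraMap R (integralClosure R F) t)) {d : ℕ}
    (φ : ExtensionQuotient R (integralClosure R F) ≃ₗ[R]
      (Fin d → F ⧸ Subalgebra.toSubmodule (integralClosure R F))) :
    ∃ y : Fin d → R, IsBasisModulo t y := by
  have htF : algebraMap R F t ≠ 0 := by simpa using ne_zero_of_irreducible ht
  let e : F ⧸ Subalgebra.toSubmodule (integralClosure R F) :=
    Submodule.Quotient.mk (1 / algebraMap R F t)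
  have he : ∀ r : R, r • e = Submodule.Quotient.mk (algebraMap R F r / algebraMap R F t) := by
    intro r
    rw [← Submodule.Quotient.mk_smul, Algebra.smul_def, mul_one_div]
  have hte : t • e = 0 := by
    rw [he, div_self htF, Subalgebra.quotient_mk_eq_zero]
    exact one_mem _
  choose u hu using fun i => Submodule.Quotient.mk_surjective _ (φ.symm (Pi.single i e))
  have hφ : ∀ r : Fin d → R, φ (Submodule.Quotient.mk (∑ i, r i • u i)) = fun i => r i • e := by
    intro r
    rw [← Submodule.mkQ_apply, map_sum, map_sum]
    simp only [map_smul, Submodule.mkQ_apply, hu, LinearEquiv.apply_symm_apply]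
    ext j
    rw [Finset.sum_apply, Finset.sum_eq_single j]
    · simp
    · intro i _ hij
      simp [hij.symm]
    · simp
  have htu : ∀ i, ∃ y : R, algebraMap R F y = algebraMap R F t * u i := by
    intro i
    have h : t • (Submodule.Quotient.mk (u i) : ExtensionQuotient R (integralClosure R F)) = 0 := by
      rw [hu, ← map_smul, LinearEquiv.map_eq_zero_iff, ← Pi.single_smul, hte, Pi.single_zero]
    rw [← Submodule.Quotient.mk_smul, ExtensionQuotient.mk_eq_zero] at h
    obtain ⟨y, hy⟩ := Algebra.mem_bot.1 h
    refine ⟨y, hy.trans ?_⟩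
    change t • (u i : F) = _
    rw [Algebra.smul_def]
  choose y hy using htu
  have hsum : ∀ r : Fin d → R, algebraMap R F (∑ i, r i * y i) =
      algebraMap R F t * ((∑ i, r i • u i : integralClosure R F) : F) := by
    intro r
    rw [AddSubmonoidClass.coe_finsetSum, map_sum, Finset.mul_sum]
    refine Finset.sum_congr rfl fun i _ => ?_
    change _ = _ * (r i • (u i : F))
    rw [map_mul, hy, Algebra.smul_def]; ring
  refine ⟨y, ?_, ?_, ?_⟩
  · intro i
    rw [H.mem_maximalIdeal_iff ht, hy, mul_div_cancel_left₀ _ htF]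
    exact (u i).2
  · intro x hx
    have hxV := (H.mem_maximalIdeal_iff ht).1 hx
    have htx : t • φ (Submodule.Quotient.mk ⟨_, hxV⟩) = 0 := by
      rw [← map_smul, LinearEquiv.map_eq_zero_iff, ← Submodule.Quotient.mk_smul,
        ExtensionQuotient.mk_eq_zero]
      change t • (algebraMap R F x / algebraMap R F t) ∈ _
      rw [Algebra.smul_def, mul_div_cancel₀ _ htF]
      exact algebraMap_mem _ _
    choose r hr using fun i => H.exists_smul_mk_of_smul_eq_zero ht (congrFun htx i)
    have h : φ (Submodule.Quotient.mk ⟨_, hxV⟩) = φ (Submodule.Quotient.mk (∑ i, r i • u i)) := by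
      rw [hφ]
      ext i
      rw [hr, he]
    have h := φ.injective h
    rw [← sub_eq_zero, ← Submodule.Quotient.mk_sub, ExtensionQuotient.mk_eq_zero] at h
    obtain ⟨s, hs⟩ := Algebra.mem_bot.1 h
    rw [AddSubgroupClass.coe_sub] at hs
    refine ⟨r, s, IsFractionRing.injective R F ?_⟩
    rw [map_add, hsum, map_mul, hs]
    field_simp
    ring
  · intro r s hrs i
    have h : (Submodule.Quotient.mk (∑ i, r i • u i) :
        ExtensionQuotient R (integralClosure R F)) = 0 := by
      rw [ExtensionQuotient.mk_eq_zero]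
      refine Algebra.mem_bot.2 ⟨s, mul_left_cancel₀ htF ?_⟩
      rw [← hsum, hrs, map_mul, mul_comm]
    have h1 := hφ r
    rw [h, map_zero] at h1
    rw [H.mem_maximalIdeal_iff ht, ← Subalgebra.quotient_mk_eq_zero, ← he]
    exact (congrFun h1 i).symm

end

/-! ### Embedding dimension through the cotangent space -/

section Cotangent

variable {R : Type u} [CommRing R] [IsLocalRing R]

open IsLocalRing

theorem residue_smul_cotangentSpace (r : R) (x : CotangentSpace R) : residue R r • x = r • x :=
  algebraMap_smul (ResidueField R) r x

theorem sum_smul_toCotangent {t : R} (ht : t ∈ maximalIdeal R) {d : ℕ} {y : Fin d → R}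
    (hy : ∀ i, y i ∈ maximalIdeal R) (r : Fin d → R) (s : R) :
    s • (maximalIdeal R).toCotangent ⟨t, ht⟩ +
      ∑ i, r i • (maximalIdeal R).toCotangent ⟨y i, hy i⟩ =
    (maximalIdeal R).toCotangent ⟨∑ i, r i * y i + s * t,
      add_mem (sum_mem fun i _ => Ideal.mul_mem_left _ _ (hy i)) (Ideal.mul_mem_left _ _ ht)⟩ := by
  simp only [← map_smul, ← map_sum, ← map_add]
  congr 1
  ext
  simp [add_comm]

variable [IsDomain R] {t : R} (ht : t ∈ maximalIdeal R) (ht0 : t ≠ 0)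
  (hsq : maximalIdeal R ^ 2 ≤ Ideal.span {t} * maximalIdeal R)
include ht ht0 hsq

/-- A basis of the maximal ideal modulo `t`, together with `t`, is a basis of the cotangent
space. -/
theorem IsBasisModulo.rank_cotangentSpace {d : ℕ} {y : Fin d → R} (hy : IsBasisModulo t y) :
    Module.rank (ResidueField R) (CotangentSpace R) = (d + 1 : ℕ) := by
  let b : Fin (d + 1) → CotangentSpace R :=
    Fin.cons ((maximalIdeal R).toCotangent ⟨t, ht⟩)
      fun i => (maximalIdeal R).toCotangent ⟨y i, hy.mem i⟩
  have hb : ∀ r : Fin (d + 1) → R, ∑ i, residue R (r i) • b i = (maximalIdeal R).toCotangent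
      ⟨∑ i : Fin d, r i.succ * y i + r 0 * t, add_mem (sum_mem fun i _ =>
        Ideal.mul_mem_left _ _ (hy.mem i)) (Ideal.mul_mem_left _ _ ht)⟩ := by
    intro r
    rw [← sum_smul_toCotangent ht hy.mem (fun i => r i.succ) (r 0), Fin.sum_univ_succ]
    simp only [residue_smul_cotangentSpace]
    rfl
  have hli : LinearIndependent (ResidueField R) b := by
    rw [Fintype.linearIndependent_iff]
    intro c hc
    choose r hr using fun i => residue_surjective (c i)
    obtain rfl : (fun i => residue R (r i)) = c := funext hr
    rw [hb, Ideal.toCotangent_eq_zero] at hc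
    -- The inclusion `M ^ 2 ⊆ tM` is used twice: first to put the coefficients of `y` in `M`, then,
    -- as their sum now lies in `M ^ 2`, to put that of `t` in `M`.
    obtain ⟨a, ha, hat⟩ := Ideal.mem_span_singleton_mul.1 (hsq hc)
    have h1 : ∀ i : Fin d, r i.succ ∈ maximalIdeal R :=
      hy.mem_of_eq (fun i => r i.succ) (a - r 0) (by linear_combination -hat)
    have h2 : ∑ i : Fin d, r i.succ * y i ∈ maximalIdeal R ^ 2 := by
      rw [pow_two]
      exact sum_mem fun i _ => Ideal.mul_mem_mul (h1 i) (hy.mem i)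
    obtain ⟨a', ha', hat'⟩ := Ideal.mem_span_singleton_mul.1 (hsq h2)
    have h3 : r 0 = a - a' := mul_left_cancel₀ ht0 (by linear_combination -hat + hat')
    intro i
    rw [residue_eq_zero_iff]
    refine Fin.cases ?_ h1 i
    rw [h3]
    exact sub_mem ha ha'
  have hsp : ⊤ ≤ Submodule.span (ResidueField R) (Set.range b) := by
    rintro x -
    obtain ⟨⟨x, hx⟩, rfl⟩ := (maximalIdeal R).toCotangent_surjective x
    obtain ⟨r, s, rfl⟩ := hy.exists_eq x hx
    have := hb (Fin.cons s r)
    simp only [Fin.cons_succ, Fin.cons_zero] at this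
    rw [← this]
    exact sum_mem fun i _ => Submodule.smul_mem _ _ (Submodule.subset_span ⟨i, rfl⟩)
  rw [rank_eq_card_basis (Module.Basis.mk hli hsp), Fintype.card_fin]

omit ht0 hsq [IsDomain R] in
theorem IsBasisModulo.fg {d : ℕ} {y : Fin d → R} (hy : IsBasisModulo t y) :
    (maximalIdeal R).FG := by
  have : maximalIdeal R = Ideal.span (Set.range y) ⊔ Ideal.span {t} := by
    apply le_antisymm
    · intro x hx
      obtain ⟨r, s, rfl⟩ := hy.exists_eq x hx
      exact add_mem (Ideal.mem_sup_left (sum_mem fun i _ =>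
        Ideal.mul_mem_left _ _ (Ideal.subset_span ⟨i, rfl⟩))) (Ideal.mem_sup_right
        (Ideal.mul_mem_left _ _ (Ideal.mem_span_singleton_self t)))
    · refine sup_le (Ideal.span_le.2 ?_) ((Ideal.span_singleton_le_iff_mem _).2 ht)
      rintro _ ⟨i, rfl⟩
      exact hy.mem i
  rw [this]
  exact (Submodule.fg_span (Set.finite_range y)).sup (Submodule.fg_span_singleton t)

theorem IsBasisModulo.embeddingDimension_eq {d : ℕ} {y : Fin d → R} (hy : IsBasisModulo t y) :
    embeddingDimension R = (d + 1 : ℕ) := by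
  rw [embeddingDimension, ← rank_cotangentSpace_eq_spanrank_maximalIdeal_of_fg (hy.fg ht),
    hy.rank_cotangentSpace ht ht0 hsq]

/-- The class of `t` is nonzero, since `t ∈ tM` would put `1` in `M`. Lift a basis of the cotangent
space modulo this class; error terms in `M ^ 2` are absorbed into `tR`. -/
theorem exists_isBasisModulo_of_rank_cotangentSpace {d : ℕ}
    (hd : Module.rank (ResidueField R) (CotangentSpace R) = (d + 1 : ℕ)) :
    ∃ y : Fin d → R, IsBasisModulo t y := by
  have hfr := Module.finrank_eq_of_rank_eq hd
  have : Module.Finite (ResidueField R) (CotangentSpace R) :=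
    Module.finite_of_finrank_pos (by omega)
  set v := (maximalIdeal R).toCotangent ⟨t, ht⟩ with hv
  have hv0 : v ≠ 0 := by
    rw [hv, Ne, Ideal.toCotangent_eq_zero]
    intro h
    obtain ⟨a, ha, hat⟩ := Ideal.mem_span_singleton_mul.1 (hsq h)
    have : a = 1 := mul_left_cancel₀ ht0 (by rw [hat, mul_one])
    rw [this] at ha
    exact ha isUnit_one
  let L := Submodule.span (ResidueField R) {v}
  have hfq : Module.finrank (ResidueField R) (CotangentSpace R ⧸ L) = d := by
    have h1 : Module.finrank (ResidueField R) (CotangentSpace R ⧸ L) +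
        Module.finrank (ResidueField R) L = Module.finrank (ResidueField R) (CotangentSpace R) :=
      L.finrank_quotient_add_finrank
    rw [finrank_span_singleton hv0, hfr] at h1
    omega
  let β := Module.finBasisOfFinrankEq (ResidueField R) (CotangentSpace R ⧸ L) hfq
  choose η hη using fun i => L.mkQ_surjective (β i)
  choose y hy using fun i => (maximalIdeal R).toCotangent_surjective (η i)
  have hker : ∀ r : Fin d → R, ∀ x (hx : x ∈ maximalIdeal R),
      L.mkQ ((maximalIdeal R).toCotangent ⟨x, hx⟩) = ∑ i, residue R (r i) • β i →
      ∃ s, x = ∑ i, r i * (y i : R) + s * t := by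
    intro r x hx h
    have h1 : L.mkQ ((maximalIdeal R).toCotangent ⟨x, hx⟩ -
        ∑ i, r i • (maximalIdeal R).toCotangent (y i)) = 0 := by
      simp only [map_sub, h, map_sum, ← residue_smul_cotangentSpace, map_smul, hy, hη, sub_self]
    rw [Submodule.mkQ_apply, Submodule.Quotient.mk_eq_zero, Submodule.mem_span_singleton] at h1
    obtain ⟨c, hc⟩ := h1
    obtain ⟨s, rfl⟩ := residue_surjective c
    rw [residue_smul_cotangentSpace, eq_sub_iff_add_eq,
      sum_smul_toCotangent ht (fun i => (y i).2), eq_comm, Ideal.toCotangent_eq] at hc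
    obtain ⟨a, -, hat⟩ := Ideal.mem_span_singleton_mul.1 (hsq hc)
    exact ⟨s + a, by simp only at hat; linear_combination -hat⟩
  refine ⟨fun i => y i, fun i => (y i).2, ?_, ?_⟩
  · intro x hx
    choose r hr using fun i => residue_surjective
      (β.repr (L.mkQ ((maximalIdeal R).toCotangent ⟨x, hx⟩)) i)
    refine ⟨r, hker r x hx ?_⟩
    simp only [hr]
    exact (β.sum_repr _).symm
  · intro r s hrs i
    rw [← residue_eq_zero_iff]
    refine Fintype.linearIndependent_iff.1 β.linearIndependent (fun i => residue R (r i)) ?_ i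
    have h1 := sum_smul_toCotangent ht (fun i => (y i).2) r (-s)
    have h2 := congrArg L.mkQ h1
    have h3 : L.mkQ v = 0 := by
      rw [Submodule.mkQ_apply, Submodule.Quotient.mk_eq_zero]
      exact Submodule.mem_span_singleton_self v
    simp only [hrs, ← residue_smul_cotangentSpace, map_add, map_sum, map_smul, hy, hη,
      neg_mul, add_neg_cancel] at h2
    rw [← hv, h3, smul_zero, zero_add] at h2
    rw [h2]
    have h4 : (⟨0, (maximalIdeal R).zero_mem⟩ : maximalIdeal R) = 0 := rfl
    rw [h4, map_zero, map_zero]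

theorem exists_isBasisModulo_of_embeddingDimension_eq [IsNoetherianRing R] {d : ℕ}
    (hd : embeddingDimension R = (d + 1 : ℕ)) : ∃ y : Fin d → R, IsBasisModulo t y := by
  rw [embeddingDimension, ← rank_cotangentSpace_eq_spanrank_maximalIdeal] at hd
  exact exists_isBasisModulo_of_rank_cotangentSpace ht ht0 hsq hd

end Cotangent

/-- For `x, y ∈ M` the product is `t` times `t * (x / t) * (y / t)`, which lies in `R` by the
`V`-structure on `V / R` and in `tV`. -/
theorem IsBadNormalization.maximalIdeal_sq_le {R : Type u} {F : Type v} [CommRing R] [IsDomain R]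
    [IsLocalRing R] [Field F] [Algebra R F] [IsFractionRing R F] (H : IsBadNormalization R F)
    {t : R} (ht : Irreducible (algebraMap R (integralClosure R F) t)) :
    IsLocalRing.maximalIdeal R ^ 2 ≤ Ideal.span {t} * IsLocalRing.maximalIdeal R := by
  have htF : algebraMap R F t ≠ 0 := by simpa using ne_zero_of_irreducible ht
  rw [pow_two, Ideal.mul_le]
  intro x hx y hy
  rw [Ideal.mem_span_singleton_mul]
  have hxV := (H.mem_maximalIdeal_iff ht).1 hx
  have hyV := (H.mem_maximalIdeal_iff ht).1 hy
  have h := H.smul_mul_mem t _ hxV _ hyV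
    (by rw [mul_div_cancel₀ _ htF]; exact algebraMap_mem _ _)
    (by rw [mul_div_cancel₀ _ htF]; exact algebraMap_mem _ _)
  obtain ⟨a, ha⟩ := Algebra.mem_bot.1 h
  refine ⟨a, ?_, ?_⟩
  · rw [H.mem_maximalIdeal_iff ht, ha, mul_div_cancel_left₀ _ htF]
    exact mul_mem hxV hyV
  · apply IsFractionRing.injective R F
    rw [map_mul, ha, map_mul]
    field_simp

/-! ### Transport of module properties along isomorphisms -/

section Transfer

variable {R : Type u} [CommRing R] {M : Type v} {N : Type w} [AddCommGroup M] [Module R M]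
  [AddCommGroup N] [Module R N]

theorem IsDivisibleModule.of_linearEquiv (e : M ≃ₗ[R] N) (h : IsDivisibleModule R M) :
    IsDivisibleModule R N := by
  intro c hc l
  obtain ⟨l', hl'⟩ := h c hc (e.symm l)
  exact ⟨e l', by rw [← map_smul, ← hl', e.apply_symm_apply]⟩

theorem IsUniserialModule.of_linearEquiv (e : M ≃ₗ[R] N) (h : IsUniserialModule R M) :
    IsUniserialModule R N := by
  intro A B
  have := h (A.comap e.toLinearMap) (B.comap e.toLinearMap)
  rwa [Submodule.comap_le_comap_iff_of_surjective e.surjective,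
    Submodule.comap_le_comap_iff_of_surjective e.surjective] at this

theorem isUniserialModule_of_mem_span_singleton
    (h : ∀ x y : M, x ∈ Submodule.span R {y} ∨ y ∈ Submodule.span R {x}) :
    IsUniserialModule R M := by
  intro A B
  by_contra! hAB
  obtain ⟨a, haA, haB⟩ := SetLike.not_le_iff_exists.1 hAB.1
  obtain ⟨b, hbB, hbA⟩ := SetLike.not_le_iff_exists.1 hAB.2
  rcases h a b with h | h
  · exact haB ((Submodule.span_singleton_le_iff_mem b B).2 hbB h)
  · exact hbA ((Submodule.span_singleton_le_iff_mem a A).2 haA h)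

theorem DirectSum.isInternal_map_range_single {d : ℕ} (φ : M ≃ₗ[R] (Fin d → N)) :
    DirectSum.IsInternal fun i =>
      (LinearMap.range (LinearMap.single R (fun _ : Fin d => N) i)).map φ.symm.toLinearMap := by
  rw [DirectSum.isInternal_submodule_iff_iSupIndep_and_iSup_eq_top]
  constructor
  · refine iSupIndep.map_orderIso (f := Submodule.orderIsoMapComap φ.symm) ?_
    intro i
    have := LinearMap.disjoint_single_single R (fun _ : Fin d => N) {i} {j | j ≠ i}
      (by simp)
    simpa using this
  · rw [← Submodule.map_iSup, LinearMap.iSup_range_single, Submodule.map_top, LinearEquiv.range]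

end Transfer

/-! ### `F / V` as the torsion divisible uniserial module -/

section FractionFieldQuotient

variable {R : Type u} {F : Type v} [CommRing R] [IsDomain R] [IsLocalRing R] [Field F] [Algebra R F]
  [IsFractionRing R F]

open IsLocalRing

omit [IsDomain R] [IsLocalRing R] in
-- In `F / V`, `V`-multiples are already `R`-multiples: with `b` a denominator of `p`, write `q / p
-- = r + b * z`; then `p * b * z ∈ V`.
theorem IsBadNormalization.mk_mem_span_singleton (H : IsBadNormalization R F) {p q : F}
    (hp : p ≠ 0) (hqp : q / p ∈ integralClosure R F) :
    (Submodule.Quotient.mk q : F ⧸ Subalgebra.toSubmodule (integralClosure R F)) ∈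
      Submodule.span R {Submodule.Quotient.mk p} := by
  obtain ⟨a, b, hb, hab⟩ := IsFractionRing.div_surjective (A := R) p
  have hb0 : b ≠ 0 := by
    rintro rfl
    exact hp (by rw [← hab, map_zero, div_zero])
  have hbF : algebraMap R F b ≠ 0 := by simpa using hb0
  obtain ⟨r, z, hz, h⟩ := H.exists_eq_add b hb0 _ hqp
  rw [Submodule.mem_span_singleton]
  refine ⟨r, ?_⟩
  rw [← Submodule.Quotient.mk_smul, eq_comm, ← sub_eq_zero, ← Submodule.Quotient.mk_sub,
    Subalgebra.quotient_mk_eq_zero, Algebra.smul_def]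
  have : q - algebraMap R F r * p = algebraMap R F a * z := by
    rw [div_eq_iff hp] at h
    rw [div_eq_iff hbF] at hab
    rw [h, hab]; ring
  rw [this]
  exact mul_mem (algebraMap_mem _ _) hz

omit [IsDomain R] [IsLocalRing R] in
theorem IsBadNormalization.isUniserialModule (H : IsBadNormalization R F) :
    IsUniserialModule R (F ⧸ Subalgebra.toSubmodule (integralClosure R F)) := by
  have := H.isDiscreteValuationRing
  refine isUniserialModule_of_mem_span_singleton fun x y => ?_
  obtain ⟨p, rfl⟩ := Submodule.Quotient.mk_surjective _ x
  obtain ⟨q, rfl⟩ := Submodule.Quotient.mk_surjective _ y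
  by_cases hp : p = 0
  · left; rw [hp]; exact zero_mem _
  by_cases hq : q = 0
  · right; rw [hq]; exact zero_mem _
  rcases ValuationRing.isInteger_or_isInteger (integralClosure R F) (q / p) with ⟨v, hv⟩ | ⟨v, hv⟩
  · right
    exact H.mk_mem_span_singleton hp (hv ▸ v.2)
  · left
    rw [inv_div] at hv
    exact H.mk_mem_span_singleton hq (hv ▸ v.2)

omit [IsDomain R] [IsLocalRing R] in
/-- Every element of `F` outside the normalization is a unit times a negative power of a
uniformizer. -/
theorem exists_unit_mul_inv_pow [IsDiscreteValuationRing (integralClosure R F)]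
    {ϖ : integralClosure R F} (hϖ : Irreducible ϖ) {q : F} (hq : q ∉ integralClosure R F) :
    ∃ (u : (integralClosure R F)ˣ) (k : ℕ), q = (u : integralClosure R F) * (ϖ : F)⁻¹ ^ (k + 1) := by
  rcases ValuationRing.isInteger_or_isInteger (integralClosure R F) q with ⟨v, hv⟩ | ⟨v, hv⟩
  · exact absurd (hv ▸ v.2) hq
  have hq0 : q ≠ 0 := fun h => hq (h ▸ zero_mem _)
  have hvq : (v : F) = q⁻¹ := hv
  have hv0 : v ≠ 0 := by
    rintro rfl
    exact inv_ne_zero hq0 hvq.symm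
  obtain ⟨k, u, hu⟩ := IsDiscreteValuationRing.eq_unit_mul_pow_irreducible hv0 hϖ
  have hq' : q = ((u⁻¹ : (integralClosure R F)ˣ) : integralClosure R F) * (ϖ : F)⁻¹ ^ k := by
    have h1 : (v : F) = (u : integralClosure R F) * (ϖ : F) ^ k := congrArg Subtype.val hu
    have h2 : (((u⁻¹ : (integralClosure R F)ˣ) : integralClosure R F) : F) *
        ((u : integralClosure R F) : F) = 1 := congrArg Subtype.val u.inv_mul
    have hϖ0 : (ϖ : F) ≠ 0 := fun h => hϖ.ne_zero (Subtype.ext h)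
    have h3 : q * v = 1 := by rw [hvq, mul_inv_cancel₀ hq0]
    rw [h1] at h3
    rw [inv_pow, eq_mul_inv_iff_mul_eq₀ (pow_ne_zero k hϖ0)]
    linear_combination (((u⁻¹ : (integralClosure R F)ˣ) : integralClosure R F) : F) * h3
      - q * (ϖ : F) ^ k * h2
  obtain _ | k := k
  · refine absurd ?_ hq
    rw [hq', pow_zero, mul_one]
    exact Subtype.prop _
  · exact ⟨u⁻¹, k, hq'⟩

theorem IsBadNormalization.isArtinian (H : IsBadNormalization R F) :
    IsArtinian R (F ⧸ Subalgebra.toSubmodule (integralClosure R F)) := by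
  have := H.isDiscreteValuationRing
  obtain ⟨t, ht⟩ := H.exists_irreducible
  have htF : algebraMap R F t ≠ 0 := by simpa using ne_zero_of_irreducible ht
  let x : ℕ → F ⧸ Subalgebra.toSubmodule (integralClosure R F) :=
    fun k => Submodule.Quotient.mk ((algebraMap R F t)⁻¹ ^ k)
  have hx : ∀ k, t • x (k + 1) = x k := by
    intro k
    rw [← Submodule.Quotient.mk_smul, Algebra.smul_def, pow_succ', mul_inv_cancel_left₀ htF]
  have hdown : ∀ (A : Submodule R (F ⧸ Subalgebra.toSubmodule (integralClosure R F))) (k l : ℕ),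
      k ≤ l → x l ∈ A → x k ∈ A := by
    intro A k l hkl h
    obtain ⟨j, rfl⟩ := Nat.exists_eq_add_of_le hkl
    rw [← pow_smul_chain hx k j]
    exact A.smul_mem _ h
  have hequiv : ∀ a : F ⧸ Subalgebra.toSubmodule (integralClosure R F), a = 0 ∨
      ∃ k, ∀ A : Submodule R (F ⧸ Subalgebra.toSubmodule (integralClosure R F)),
        a ∈ A ↔ x k ∈ A := by
    intro a
    obtain ⟨q, rfl⟩ := Submodule.Quotient.mk_surjective _ a
    by_cases hq : q ∈ integralClosure R F
    · exact Or.inl ((Subalgebra.quotient_mk_eq_zero q).2 hq)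
    right
    obtain ⟨u, k, rfl⟩ := exists_unit_mul_inv_pow ht hq
    have htk : (algebraMap R F t)⁻¹ ^ (k + 1) ≠ 0 := pow_ne_zero _ (inv_ne_zero htF)
    have hu : ((u : integralClosure R F) : F) ≠ 0 := fun h => u.ne_zero (Subtype.ext h)
    refine ⟨k + 1, fun A => ⟨fun h => ?_, fun h => ?_⟩⟩
    · refine (Submodule.span_singleton_le_iff_mem _ A).2 h
        (H.mk_mem_span_singleton (mul_ne_zero hu htk) ?_)
      convert (((u⁻¹ : (integralClosure R F)ˣ) : integralClosure R F)).2
      have h1 : (((u⁻¹ : (integralClosure R F)ˣ) : integralClosure R F) : F) *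
        ((u : integralClosure R F) : F) = 1 := congrArg Subtype.val u.inv_mul
      refine (div_eq_iff (mul_ne_zero hu htk)).2 ?_
      rw [← mul_assoc, h1, one_mul]
    · refine (Submodule.span_singleton_le_iff_mem _ A).2 h (H.mk_mem_span_singleton htk ?_)
      convert (u : integralClosure R F).2
      exact mul_div_cancel_right₀ _ htk
  -- A submodule is determined by the least `k` with `t ^ (-k)` outside it (`⊤` if there is none),
  -- so `ν` embeds the lattice strictly monotonically in a well-founded order.
  let ν : Submodule R (F ⧸ Subalgebra.toSubmodule (integralClosure R F)) → ℕ∞ :=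
    fun A => ⨅ k : {k : ℕ // x k ∉ A}, (k : ℕ∞)
  have hν : StrictMono ν := by
    intro A B hAB
    obtain ⟨b, hbB, hbA⟩ := SetLike.exists_of_lt hAB
    obtain rfl | ⟨k, hk⟩ := hequiv b
    · exact absurd (zero_mem _) hbA
    rw [hk] at hbB hbA
    have h1 : ν A ≤ k := iInf_le (fun k : {k : ℕ // x k ∉ A} => (k : ℕ∞)) ⟨k, hbA⟩
    have h2 : ((k + 1 : ℕ) : ℕ∞) ≤ ν B := by
      refine le_iInf fun l => ?_
      have : k + 1 ≤ l := by
        by_contra h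
        exact l.2 (hdown B l k (by omega) hbB)
      exact_mod_cast this
    exact lt_of_le_of_lt h1 (lt_of_lt_of_le (by exact_mod_cast Nat.lt_succ_self k) h2)
  exact hν.wellFoundedLT


omit [IsDomain R] [IsLocalRing R] [IsFractionRing R F] in
theorem Subalgebra.mem_of_inv_mem_of_isIntegral {W : Subalgebra R F}
    (hW : ∀ q : F, q ∈ W ∨ q⁻¹ ∈ W) : integralClosure R F ≤ W := by
  intro q hq
  let O : ValuationSubring F := ⟨W.toSubring, hW⟩
  obtain ⟨p, hp, hpq⟩ := hq
  have : IsIntegral O q := by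
    refine ⟨p.map (algebraMap R W : R →+* O), hp.map _, ?_⟩
    rw [Polynomial.eval₂_map]
    exact hpq
  obtain ⟨y, hy⟩ := (IsIntegrallyClosed.isIntegral_iff (R := O) (K := F)).1 this
  rw [← hy]
  exact y.2

omit [IsDomain R] in
/-- The kernel of a linear map from `F` onto a uniserial module is stable under the
normalization. -/
theorem IsUniserialModule.mul_mem_ker {B : Type w} [AddCommGroup B] [Module R B]
    (hB : IsUniserialModule R B) (f : F →ₗ[R] B) {v q : F}
    (hv : v ∈ integralClosure R F) (hq : f q = 0) : f (v * q) = 0 := by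
  let W : Subalgebra R F :=
    { carrier := {x | ∀ q, f q = 0 → f (x * q) = 0}
      mul_mem' := fun {a b} ha hb q hq => by rw [mul_assoc]; exact ha _ (hb q hq)
      add_mem' := fun {a b} ha hb q hq => by rw [add_mul, map_add, ha q hq, hb q hq, add_zero]
      algebraMap_mem' := fun r q hq => by rw [← Algebra.smul_def, map_smul, hq, smul_zero] }
  refine Subalgebra.mem_of_inv_mem_of_isIntegral (W := W) ?_ hv q hq
  -- Fractions are compared through the submodules `{q | f (s • q) = 0}`. They contain the kernel of
  -- `f`, so uniseriality of `B` makes them comparable, and each inclusion puts `r / s` or its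
  -- inverse in `W`.
  have hcomp : ∀ r s : R, s ≠ 0 →
      (LinearMap.ker f).comap (LinearMap.lsmul R F s) ≤
        (LinearMap.ker f).comap (LinearMap.lsmul R F r) →
      algebraMap R F r / algebraMap R F s ∈ W := by
    intro r s hs hle q hq
    have hsF : algebraMap R F s ≠ 0 := by simpa using hs
    have h1 : q / algebraMap R F s ∈ (LinearMap.ker f).comap (LinearMap.lsmul R F s) := by
      change f (s • _) = 0
      rwa [Algebra.smul_def, mul_div_cancel₀ _ hsF]
    have h2 : f (r • (q / algebraMap R F s)) = 0 := hle h1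
    rwa [Algebra.smul_def, ← mul_div_assoc, mul_div_right_comm] at h2
  have hle : ∀ A C : Submodule R F, LinearMap.ker f ≤ A → LinearMap.ker f ≤ C → A ≤ C ∨ C ≤ A := by
    intro A C hA hC
    have := hB (A.map f) (C.map f)
    rwa [Submodule.map_le_iff_le_comap, Submodule.map_le_iff_le_comap, Submodule.comap_map_eq,
      Submodule.comap_map_eq, sup_eq_left.2 hA, sup_eq_left.2 hC] at this
  have hker : ∀ r : R, LinearMap.ker f ≤ (LinearMap.ker f).comap (LinearMap.lsmul R F r) := by
    intro r q hq
    change f (r • q) = 0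
    rw [map_smul, LinearMap.mem_ker.1 hq, smul_zero]
  intro q
  by_cases hq : q = 0
  · left; rw [hq]; exact zero_mem W
  obtain ⟨r, s, hs, rfl⟩ := IsFractionRing.div_surjective (A := R) q
  have hs0 : s ≠ 0 := nonZeroDivisors.ne_zero hs
  have hr0 : r ≠ 0 := by
    rintro rfl
    exact hq (by rw [map_zero, zero_div])
  rcases hle _ _ (hker s) (hker r) with h | h
  · exact Or.inl (hcomp r s hs0 h)
  · right
    rw [inv_div]
    exact hcomp s r hr0 h

/-- A torsion divisible uniserial module is isomorphic to `F` modulo the normalization, if the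
latter is a discrete valuation ring. -/
theorem IsUniserialModule.nonempty_linearEquiv [IsDiscreteValuationRing (integralClosure R F)]
    {B : Type w} [AddCommGroup B] [Module R B] [Nontrivial B] (hB : IsUniserialModule R B)
    (hdiv : IsDivisibleModule R B)
    (htors : ∀ t ∈ maximalIdeal R, ∀ x : B, ∃ k : ℕ, t ^ k • x = 0) :
    Nonempty (B ≃ₗ[R] (F ⧸ Subalgebra.toSubmodule (integralClosure R F))) := by
  have hR : ringKrullDim R = 1 := ringKrullDim_eq_one_of_isDiscreteValuationRing (F := F)
  obtain ⟨t, ht, ht0⟩ := exists_mem_maximalIdeal_ne_zero hR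
  have htF : algebraMap R F t ≠ 0 := by simpa using ht0
  obtain ⟨b, hb0, hb⟩ : ∃ b : B, b ≠ 0 ∧ t • b = 0 := by
    classical
    obtain ⟨x, hx⟩ := exists_ne (0 : B)
    have h := htors t ht x
    obtain ⟨k, hk⟩ : ∃ k, Nat.find h = k + 1 := by
      refine Nat.exists_eq_succ_of_ne_zero fun h0 => hx ?_
      have := Nat.find_spec h
      rwa [h0, pow_zero, one_smul] at this
    refine ⟨t ^ k • x, Nat.find_min h (by omega), ?_⟩
    rw [← mul_smul, ← pow_succ', ← hk]
    exact Nat.find_spec h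
  obtain ⟨x, hx0, hx1, hx⟩ := exists_smul_chain (fun x => by
    obtain ⟨y, hy⟩ := hdiv t (mem_nonZeroDivisors_of_ne_zero ht0) x
    exact ⟨y, hy.symm⟩) hb
  obtain ⟨f, hf⟩ := exists_linearMap_of_smul_chain (exists_pow_mul_eq_algebraMap (F := F) hR ht) hx
  have hf1 : f 1 = 0 := by
    rw [hf 1 0 1 (by simp), hx0, smul_zero]
  have hfb : f (algebraMap R F t)⁻¹ = b := by
    rw [hf _ 1 1 (by rw [pow_one, mul_inv_cancel₀ htF, map_one]), hx1, one_smul]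
  have hsurj : Function.Surjective f := by
    rw [← LinearMap.range_eq_top, eq_top_iff]
    intro y _
    -- Were the range inside `R y` with `t ^ k • y = 0`, then `t ^ k` would kill the image of `t ^
    -- (-(k + 1))`, yet it sends it to `b ≠ 0`.
    rcases hB (LinearMap.range f) (Submodule.span R {y}) with h | h
    · exfalso
      obtain ⟨k, hk⟩ := htors t ht y
      obtain ⟨r, hr⟩ := Submodule.mem_span_singleton.1
        (h ⟨(algebraMap R F t)⁻¹ ^ (k + 1), rfl⟩)
      apply hb0
      rw [← hfb]
      have : (algebraMap R F t)⁻¹ = t ^ k • (algebraMap R F t)⁻¹ ^ (k + 1) := by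
        rw [Algebra.smul_def, map_pow, pow_succ, ← mul_assoc, ← mul_pow, mul_inv_cancel₀ htF,
          one_pow, one_mul]
      rw [this, map_smul, ← hr, smul_comm, hk, smul_zero]
    · exact h (Submodule.mem_span_singleton_self y)
  obtain ⟨ϖ, hϖ⟩ := IsDiscreteValuationRing.exists_irreducible (integralClosure R F)
  have hϖ0 : (ϖ : F) ≠ 0 := fun h => hϖ.ne_zero (Subtype.ext h)
  have hex : ∃ j : ℕ, f ((ϖ : F)⁻¹ ^ j) ≠ 0 := by
    by_contra! h
    by_cases htV : (algebraMap R F t)⁻¹ ∈ integralClosure R F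
    · refine hb0 (hfb ▸ ?_)
      have := hB.mul_mem_ker f htV hf1
      rwa [mul_one] at this
    · obtain ⟨u, k, hk⟩ := exists_unit_mul_inv_pow hϖ htV
      refine hb0 (hfb ▸ ?_)
      rw [hk]
      exact hB.mul_mem_ker f (u : integralClosure R F).2 (h _)
  classical
  obtain ⟨i, hi⟩ : ∃ i, Nat.find hex = i + 1 := by
    refine Nat.exists_eq_succ_of_ne_zero fun h0 => ?_
    have := Nat.find_spec hex
    rw [h0, pow_zero] at this
    exact this hf1
  have hi0 : f ((ϖ : F)⁻¹ ^ i) = 0 := by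
    by_contra h
    exact Nat.find_min hex (by omega) h
  have hi1 : f ((ϖ : F)⁻¹ ^ (i + 1)) ≠ 0 := hi ▸ Nat.find_spec hex
  -- The kernel of `f` is `ϖ ^ (-i) * V`, where `i + 1` is the least exponent whose inverse power is
  -- not killed; rescaling by `ϖ ^ (-i)` turns the kernel into `V`.
  let g : F →ₗ[R] B := f.comp (LinearMap.mulLeft R ((ϖ : F)⁻¹ ^ i))
  have hg : Function.Surjective g := by
    refine hsurj.comp fun q => ⟨(ϖ : F) ^ i * q, ?_⟩
    rw [LinearMap.mulLeft_apply, inv_pow, inv_mul_cancel_left₀ (pow_ne_zero i hϖ0)]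
  have hker : LinearMap.ker g = Subalgebra.toSubmodule (integralClosure R F) := by
    ext q
    change f ((ϖ : F)⁻¹ ^ i * q) = 0 ↔ q ∈ integralClosure R F
    constructor
    · intro h
      by_contra hq
      obtain ⟨u, k, rfl⟩ := exists_unit_mul_inv_pow hϖ hq
      have h1 := hB.mul_mem_ker f
        (((u⁻¹ : (integralClosure R F)ˣ) * ϖ ^ k : integralClosure R F)).2 h
      have h2 : (((u⁻¹ : (integralClosure R F)ˣ) : integralClosure R F) : F) *
        ((u : integralClosure R F) : F) = 1 := congrArg Subtype.val u.inv_mul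
      have h3 : (((u⁻¹ : (integralClosure R F)ˣ) * ϖ ^ k : integralClosure R F) : F) *
          ((ϖ : F)⁻¹ ^ i * ((u : integralClosure R F) * (ϖ : F)⁻¹ ^ (k + 1))) =
          (ϖ : F)⁻¹ ^ (i + 1) := by
        have h4 : (ϖ : F) ^ k * (ϖ : F)⁻¹ ^ k = 1 := by
          rw [← mul_pow, mul_inv_cancel₀ hϖ0, one_pow]
        change (((u⁻¹ : (integralClosure R F)ˣ) : integralClosure R F) : F) * (ϖ : F) ^ k * _ = _
        rw [pow_succ, pow_succ]
        linear_combination (ϖ : F)⁻¹ ^ i * (ϖ : F)⁻¹ *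
          ((((u⁻¹ : (integralClosure R F)ˣ) : integralClosure R F) : F) *
            ((u : integralClosure R F) : F) * h4 + h2)
      rw [h3] at h1
      exact hi1 h1
    · intro hq
      rw [mul_comm]
      exact hB.mul_mem_ker f hq hi0
  exact ⟨(g.quotKerEquivOfSurjective hg).symm.trans (Submodule.quotEquivOfEq _ _ hker)⟩

end FractionFieldQuotient

/-! ### The equivalences -/

theorem corollary4p3 (R : Type u) (F : Type v) [CommRing R] [IsDomain R] [IsLocalRing R]
    [Field F] [Algebra R F] [IsFractionRing R F] (n : ℕ) (hn : 1 < n) :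
    List.TFAE [
      IsBadStableDomain R F ∧ IsNoetherianRing R ∧ embeddingDimension R = (n : Cardinal.{u}),
      IsDiscreteValuationRing (integralClosure R F) ∧
        ∃ B : Fin (n - 1) → Submodule R (ExtensionQuotient R (integralClosure R F)),
          DirectSum.IsInternal B ∧
          ∀ i, Nontrivial (B i) ∧ IsDivisibleModule R (B i) ∧ IsArtinian R (B i) ∧
            IsUniserialModule R (B i),
      IsDiscreteValuationRing (integralClosure R F) ∧
        Nonempty (ExtensionQuotient R (integralClosure R F) ≃ₗ[R]
          (Fin (n - 1) → F ⧸ Subalgebra.toSubmodule (integralClosure R F)))] := by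
  obtain ⟨d, hnd⟩ : ∃ d, n - 1 = d := ⟨_, rfl⟩
  rw [hnd]
  obtain rfl : n = d + 1 := by omega
  have hd : d ≠ 0 := by omega
  tfae_have 1 → 3 := by
    rintro ⟨hbad, hnoeth, hdim⟩
    have H := (isQuadratic_of_isStableDomain hbad.isStableDomain).isBadNormalization
      hbad.krullDim_eq_one hbad.not_finite_normalization
    obtain ⟨t, ht⟩ := H.exists_irreducible
    obtain ⟨y, hy⟩ := exists_isBasisModulo_of_embeddingDimension_eq
      (IsBadNormalization.mem_maximalIdeal_of_irreducible ht)
      (IsBadNormalization.ne_zero_of_irreducible ht) (H.maximalIdeal_sq_le ht) hdim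
    exact ⟨H.isDiscreteValuationRing, H.nonempty_linearEquiv ht hy⟩
  tfae_have 3 → 1 := by
    rintro ⟨hdvr, ⟨φ⟩⟩
    have H := isBadNormalization_of_linearEquiv hd φ
    obtain ⟨t, ht⟩ := H.exists_irreducible
    have htm := IsBadNormalization.mem_maximalIdeal_of_irreducible ht
    obtain ⟨y, hy⟩ := H.exists_isBasisModulo ht φ
    exact ⟨H.isBadStableDomain, H.isNoetherianRing (hy.fg htm), hy.embeddingDimension_eq htm
      (IsBadNormalization.ne_zero_of_irreducible ht) (H.maximalIdeal_sq_le ht)⟩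
  tfae_have 3 → 2 := by
    rintro ⟨hdvr, ⟨φ⟩⟩
    have H := isBadNormalization_of_linearEquiv hd φ
    refine ⟨hdvr, _, DirectSum.isInternal_map_range_single φ, fun i => ?_⟩
    let e : (F ⧸ Subalgebra.toSubmodule (integralClosure R F)) ≃ₗ[R]
        (LinearMap.range (LinearMap.single R (fun _ : Fin d =>
          F ⧸ Subalgebra.toSubmodule (integralClosure R F)) i)).map φ.symm.toLinearMap :=
      (LinearEquiv.ofInjective (LinearMap.single R (fun _ : Fin d =>
        F ⧸ Subalgebra.toSubmodule (integralClosure R F)) i) (Pi.single_injective (M := fun _ : Fin d =>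
          F ⧸ Subalgebra.toSubmodule (integralClosure R F)) i)).trans
        (φ.symm.submoduleMap _)
    have := H.isArtinian
    have : Nontrivial (F ⧸ Subalgebra.toSubmodule (integralClosure R F)) := by
      refine Submodule.Quotient.nontrivial_iff.2 fun h => ?_
      exact integralClosure_ne_top (R := R) (F := F) (Algebra.toSubmodule_eq_top.1 h)
    refine ⟨e.symm.toEquiv.nontrivial, .of_linearEquiv e ?_, isArtinian_of_linearEquiv e,
      .of_linearEquiv e H.isUniserialModule⟩
    intro c hc x
    obtain ⟨y, hy⟩ := Subalgebra.exists_smul_eq_quotient (nonZeroDivisors.ne_zero hc) x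
    exact ⟨y, hy.symm⟩
  tfae_have 2 → 3 := by
    rintro ⟨hdvr, B, hB, h⟩
    have he : ∀ i, Nonempty (B i ≃ₗ[R] (F ⧸ Subalgebra.toSubmodule (integralClosure R F))) := by
      intro i
      obtain ⟨hnt, hdiv, -, huni⟩ := h i
      refine huni.nonempty_linearEquiv hdiv fun t ht => ?_
      rintro ⟨x, hx⟩
      obtain ⟨v, rfl⟩ := Submodule.Quotient.mk_surjective _ x
      -- Each summand is `t`-power torsion because a power of `t` is a denominator for any element
      -- of `F`.
      obtain ⟨k, r, hk⟩ := exists_pow_mul_eq_algebraMap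
        (ringKrullDim_eq_one_of_isDiscreteValuationRing (F := F)) ht (v : F)
      refine ⟨k, Subtype.ext ?_⟩
      change t ^ k • (Submodule.Quotient.mk v : ExtensionQuotient R (integralClosure R F)) = 0
      rw [← Submodule.Quotient.mk_smul, ExtensionQuotient.mk_eq_zero]
      change t ^ k • (v : F) ∈ _
      rw [Algebra.smul_def, map_pow, hk]
      exact algebraMap_mem _ _
    have e := fun i => (he i).some
    exact ⟨hdvr, ⟨(LinearEquiv.ofBijective (DirectSum.coeLinearMap B) hB).symm.trans
      ((DirectSum.linearEquivFunOnFintype R (Fin d) fun i => B i).trans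
        (LinearEquiv.piCongrRight e))⟩⟩
  tfae_finish
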